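/- Let $n,m,p,\sigma,N$ be given, let $\mathcal P_j=(A_j,B_j,C_j,D_j)$, $1\le j\le\sigma$, be real state-space quadruples with $n$ states, $m$ inputs and $p$ outputs, let $\varphi:\{1,2,\dots\}\to\{1,\dots,\sigma\}$ be a switching sequence, and let $\mathcal P(k)=(A(k),B(k),C(k),D(k))=\mathcal P_{\varphi(k)}$. The Markov parameters are $h(k,\ell)=C(k)A(k-1)\cdots A(\ell+1)B(\ell)$ for $\ell<k$ and $h(k,k)=D(k)$. Assume: (i) every $\mathcal P_j$ is bounded-input/bounded-output stable and has McMillan degree $n$; (ii) any two consecutive switching times in $\{1,\dots,N\}$ (times $k$, $2\le k\le N$, with $\varphi(k)\ne\varphi(k-1)$) differ by at least $n$. *Algorithm 1.* Let $q=2n+1$, $r=2n$, $k'=2n+1$, $k''=N-4n$. Given an array $h(k,\ell)$, let $\mathcal H(k)$ be the $q\times r$ block matrix with blocks $h(k+i,k-1-j)$, $0\le i<q$, $0\le j<r$. For each $k'\le k\le k''+1$ let $\Sigma(k)$ be the diagonal matrix of the $n$ largest singular values of $\mathcal H(k)$ in nonincreasing order, and $U(k)$, $V(k)$ matrices of corresponding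 left and right singular vectors from a singular value decomposition of $\mathcal H(k)$. Put $\hat{\mathcal O}(k)=U(k)\Sigma(k)^{1/2}$ and $\hat{\mathcal R}(k-1)=\Sigma(k)^{1/2}V(k)^T$. For $k'\le k\le k''$ the output $\hat{\mathcal P}(k)=(\hat A(k),\hat B(k),\hat C(k),\hat D(k))$ is $$\hat A(k)=\big(J_\downarrow\hat{\mathcal O}(k+1)\big)^\dagger J_\uparrow\hat{\mathcal O}(k),\quad \hat B(k)=\text{first block column of }\hat{\mathcal R}(k),\quad \hat C(k)=\text{first block row of }\hat{\mathcal O}(k),\quad \hat D(k)=h(k,k),$$ where $J_\downarrow$ and $J_\uparrow$ delete the last and the first block row, respectively, and $X^\dagger=(X^TX)^{-1}X^T$. **Theorem.** There are $c,\varepsilon_*>0$ and a function $\omega$ with $\omega(\varepsilon)\to0$ as $\varepsilon\downarrow0$, depending only on the system and $N$, such that the following holds. Let $\hat{\mathcal P}$ be an output of Algorithm 1 on $h$, let $0<\varepsilon\le\varepsilon_*$, let $\tilde h(k,\ell)=h(k,\ell)+e(k,\ell)$ with $\|e(k,\ell)\|_F\le\varepsilon$ for $1\le\ell\le k$, $k'\le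 k\le N-2n+1$, and let $\tilde{\mathcal P}$ be an output of Algorithm 1 on $\tilde h$. Then there are a realization $\mathcal P^\varepsilon(k)=(A^\varepsilon(k),B^\varepsilon(k),C^\varepsilon(k),D^\varepsilon(k))$, $k'\le k\le k''$, and invertible matrices $S(k)\in\mathbb R^{n\times n}$, $k'\le k\le k''+1$, bounded with bounded inverses (a Lyapunov transformation), such that for all $k'\le k\le k''$ $$A^\varepsilon(k)=S(k+1)\tilde A(k)S(k)^{-1},\quad B^\varepsilon(k)=S(k+1)\tilde B(k),\quad C^\varepsilon(k)=\tilde C(k)S(k)^{-1},\quad D^\varepsilon(k)=\tilde D(k),$$ (that is, $\mathcal P^\varepsilon$ is topologically equivalent to $\tilde{\mathcal P}$), the Frobenius norms $$\|A^\varepsilon(k)-\hat A(k)\|_F,\quad\|B^\varepsilon(k)-\hat B(k)\|_F,\quad\|C^\varepsilon(k)-\hat C(k)\|_F,\quad\|D^\varepsilon(k)-\hat D(k)\|_F$$ are all at most $c\,\varepsilon$, and $S$ is asymptotically orthogonal: if $k'\le k''$, then $\|S(k)^TS(k)-I_n\|_F\le\omega(\varepsilon)$ for all $k'\le k\le k''+1$,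 so that $S(k)^TS(k)\to I_n$ as $\varepsilon\to0$. -/

import Mathlib

open Filter Topology Matrix

attribute [local instance] Matrix.frobeniusNormedAddCommGroup

/-- A state-space quadruple `(A, B, C, D)` with `n` states, `m` inputs and `p` outputs. -/
structure StateSpace (n m p : ℕ) where
  A : Matrix (Fin n) (Fin n) ℝ
  B : Matrix (Fin n) (Fin m) ℝ
  C : Matrix (Fin p) (Fin n) ℝ
  D : Matrix (Fin p) (Fin m) ℝ

namespace StateSpace

/-! Notions for a single (time-invariant) quadruple. -/

/-- State trajectory `x (k+1) = A x k + B u k` started at the origin. -/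
noncomputable def state {n m p : ℕ} (P : StateSpace n m p) (u : ℕ → Fin m → ℝ) :
    ℕ → Fin n → ℝ
  | 0 => 0
  | k + 1 => P.A *ᵥ state P u k + P.B *ᵥ u k

/-- Output `y k = C x k + D u k` for zero initial state. -/
noncomputable def output {n m p : ℕ} (P : StateSpace n m p) (u : ℕ → Fin m → ℝ) (k : ℕ) :
    Fin p → ℝ :=
  P.C *ᵥ P.state u k + P.D *ᵥ u k

/-- Bounded-input/bounded-output stability. -/
def IsBIBOStable {n m p : ℕ} (P : StateSpace n m p) : Prop :=
  ∀ u : ℕ → Fin m → ℝ, (∃ M : ℝ, ∀ k i, |u k i| ≤ M) →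
    ∃ M : ℝ, ∀ k i, |P.output u k i| ≤ M

/-- Impulse response `D, C B, C A B, C A² B, …`. -/
noncomputable def impulse {n m p : ℕ} (P : StateSpace n m p) : ℕ → Matrix (Fin p) (Fin m) ℝ
  | 0 => P.D
  | t + 1 => P.C * P.A ^ t * P.B

/-- McMillan degree: the least number of states of a time-invariant quadruple with the same
impulse response (equivalently, the same transfer function). -/
noncomputable def mcmillanDegree {n m p : ℕ} (P : StateSpace n m p) : ℕ :=
  sInf {d : ℕ | ∃ Q : StateSpace d m p, ∀ t, Q.impulse t = P.impulse t}

end StateSpace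

/-! Time-varying systems, indexed by the times `1, …, N` (other indices are never used). -/

/-- The switched linear system with discrete states `modes` and switching sequence `φ`. -/
def switchedSystem {n m p σ : ℕ} (modes : Fin σ → StateSpace n m p) (φ : ℕ → Fin σ) :
    ℕ → StateSpace n m p :=
  fun k => modes (φ k)

/-- `transitionAux P l t = A (l+t-1) ⋯ A (l+1) A l`, the product of `t` factors. -/
noncomputable def transitionAux {n m p : ℕ} (P : ℕ → StateSpace n m p) (l : ℕ) :
    ℕ → Matrix (Fin n) (Fin n) ℝ
  | 0 => 1
  | t + 1 => (P (l + t)).A * transitionAux P l t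

/-- State transition matrix `Φ(k, l) = A (k-1) ⋯ A l` for `l ≤ k`, with `Φ(k, k) = I`. -/
noncomputable def transition {n m p : ℕ} (P : ℕ → StateSpace n m p) (k l : ℕ) :
    Matrix (Fin n) (Fin n) ℝ :=
  transitionAux P l (k - l)

/-- Doubly indexed Markov parameters `h(k, l)`. -/
noncomputable def markov {n m p : ℕ} (P : ℕ → StateSpace n m p) (k l : ℕ) :
    Matrix (Fin p) (Fin m) ℝ :=
  if l < k then (P k).C * transition P k (l + 1) * (P l).B
  else if k = l then (P k).D
  else 0

/-- `k` is a switching time in `{1, …, N}`: a new segment starts at `k`. -/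
def IsSwitch {σ : ℕ} (N : ℕ) (φ : ℕ → Fin σ) (k : ℕ) : Prop :=
  2 ≤ k ∧ k ≤ N ∧ φ k ≠ φ (k - 1)

/-- The minimum dwell time is at least `d`: any two consecutive switching times differ by at
least `d`. The first and the last segment of `{1, …, N}` are not constrained. -/
def MinDwellAtLeast {σ : ℕ} (N : ℕ) (φ : ℕ → Fin σ) (d : ℕ) : Prop :=
  ∀ k l : ℕ, IsSwitch N φ k → IsSwitch N φ l → k < l →
    (∀ j, k < j → j < l → ¬ IsSwitch N φ j) → k + d ≤ l

/-- `T` is a Lyapunov transformation from `P` to `P'` over the set of times `K`: on the times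
involved (`K` and `K + 1`) it is bounded with bounded inverse, and it transforms `P` to `P'`. -/
def IsLyapunovTransformOn {n m p : ℕ} (K : Set ℕ) (T : ℕ → Matrix (Fin n) (Fin n) ℝ)
    (P P' : ℕ → StateSpace n m p) : Prop :=
  (∃ M : ℝ, ∀ k ∈ K, ∀ j ∈ ({k, k + 1} : Set ℕ),
    IsUnit (T j).det ∧ ‖T j‖ ≤ M ∧ ‖(T j)⁻¹‖ ≤ M) ∧
  ∀ k ∈ K,
    (P' k).A = T (k + 1) * (P k).A * (T k)⁻¹ ∧
    (P' k).B = T (k + 1) * (P k).B ∧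
    (P' k).C = (P k).C * (T k)⁻¹ ∧
    (P' k).D = (P k).D

/-! Hankel matrices, singular value decompositions and the realization algorithm. -/

/-- Block Hankel matrix with block entries `h(k+i, k-1-j)`, `0 ≤ i < q`, `0 ≤ j < r`. -/
def hankel {m p : ℕ} (q r : ℕ) (h : ℕ → ℕ → Matrix (Fin p) (Fin m) ℝ) (k : ℕ) :
    Matrix (Fin q × Fin p) (Fin r × Fin m) ℝ :=
  Matrix.of fun i j => h (k + i.1) (k - 1 - j.1) i.2 j.2

/-- `U`, `s`, `V` are the leading `n` left singular vectors, singular values and right singular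
vectors of `H` in some singular value decomposition
`H = [U Uₑ] (diag(s) ⊕ Σₑ) [V Vₑ]ᵀ`
with `[U Uₑ]`, `[V Vₑ]` square orthogonal, `Σₑ` rectangular diagonal with diagonal `t 0, t 1, …`,
and all the singular values nonnegative and listed in nonincreasing order. -/
def IsLeadingSVD {ι κ : Type} [Fintype ι] [Fintype κ] [DecidableEq ι] [DecidableEq κ] {n : ℕ}
    (H : Matrix ι κ ℝ) (U : Matrix ι (Fin n) ℝ) (s : Fin n → ℝ) (V : Matrix κ (Fin n) ℝ) :
    Prop :=
  ∃ (a b : ℕ) (Ue : Matrix ι (Fin a) ℝ) (Ve : Matrix κ (Fin b) ℝ) (t : ℕ → ℝ),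
    (fromCols U Ue)ᵀ * fromCols U Ue = 1 ∧ fromCols U Ue * (fromCols U Ue)ᵀ = 1 ∧
    (fromCols V Ve)ᵀ * fromCols V Ve = 1 ∧ fromCols V Ve * (fromCols V Ve)ᵀ = 1 ∧
    Antitone s ∧ Antitone t ∧ (∀ i j, t j ≤ s i) ∧ (∀ j, 0 ≤ t j) ∧
    H = fromCols U Ue *
      fromBlocks (diagonal s) 0 0
        (Matrix.of fun (i : Fin a) (j : Fin b) => if (i : ℕ) = (j : ℕ) then t i else 0) *
      (fromCols V Ve)ᵀ

/-- Block-row shift `[0 I]`, which drops the first block row. -/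
def shiftUp (q p : ℕ) : Matrix (Fin q × Fin p) (Fin (q + 1) × Fin p) ℝ :=
  Matrix.of fun i j => if j.1 = i.1.succ ∧ j.2 = i.2 then 1 else 0

/-- Block-row shift `[I 0]`, which drops the last block row. -/
def shiftDown (q p : ℕ) : Matrix (Fin q × Fin p) (Fin (q + 1) × Fin p) ℝ :=
  Matrix.of fun i j => if j.1 = i.1.castSucc ∧ j.2 = i.2 then 1 else 0

/-- `[I 0 ⋯ 0]`, which selects the first block row. -/
def selectC (q p : ℕ) : Matrix (Fin p) (Fin q × Fin p) ℝ :=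
  Matrix.of fun i j => if (j.1 : ℕ) = 0 ∧ j.2 = i then 1 else 0

/-- `[I 0 ⋯ 0]ᵀ`, which selects the first block column. -/
def selectB (r m : ℕ) : Matrix (Fin r × Fin m) (Fin m) ℝ :=
  Matrix.of fun i j => if (i.1 : ℕ) = 0 ∧ i.2 = j then 1 else 0

/-- Left inverse `(XᵀX)⁻¹Xᵀ` of a matrix of full column rank. -/
noncomputable def leftInv {ι : Type} [Fintype ι] {n : ℕ} (X : Matrix ι (Fin n) ℝ) :
    Matrix (Fin n) ι ℝ :=
  (Xᵀ * X)⁻¹ * Xᵀ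

/-- The times `2n+1 ≤ k ≤ N-4n` at which the algorithm estimates the system. -/
def estimationTimes (n N : ℕ) : Set ℕ :=
  {k | 2 * n + 1 ≤ k ∧ k + 4 * n ≤ N}

/-- `Phat` is an output of the realization algorithm, with `q = 2n+1` and `r = 2n`, on the Markov
parameters `h`. Singular value decompositions are not unique; any choice is admitted, one for each
Hankel matrix. With `O k = U k Σ(k)^{1/2}` and `R k = Σ(k)^{1/2} V(k)ᵀ` (`R k` estimates the
controllability matrix ending at time `k-1`) the estimates are `A k = (J↓ O(k+1))† J↑ O(k)`,
`B k = R(k+1) J_B`, `C k = J_C O(k)`, `D k = h(k, k)`. -/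
def IsAlgorithmOutput {n m p : ℕ} (N : ℕ) (h : ℕ → ℕ → Matrix (Fin p) (Fin m) ℝ)
    (Phat : ℕ → StateSpace n m p) : Prop :=
  ∃ (U : ℕ → Matrix (Fin (2 * n + 1) × Fin p) (Fin n) ℝ) (s : ℕ → Fin n → ℝ)
    (V : ℕ → Matrix (Fin (2 * n) × Fin m) (Fin n) ℝ)
    (O : ℕ → Matrix (Fin (2 * n + 1) × Fin p) (Fin n) ℝ)
    (R : ℕ → Matrix (Fin n) (Fin (2 * n) × Fin m) ℝ),
    (∀ k, O k = U k * diagonal fun i => Real.sqrt (s k i)) ∧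
    (∀ k, R k = (diagonal fun i => Real.sqrt (s k i)) * (V k)ᵀ) ∧
    ∀ k ∈ estimationTimes n N,
      IsLeadingSVD (hankel (2 * n + 1) (2 * n) h k) (U k) (s k) (V k) ∧
      IsLeadingSVD (hankel (2 * n + 1) (2 * n) h (k + 1)) (U (k + 1)) (s (k + 1)) (V (k + 1)) ∧
      (Phat k).A = leftInv (shiftDown (2 * n) p * O (k + 1)) * (shiftUp (2 * n) p * O k) ∧
      (Phat k).B = R (k + 1) * selectB (2 * n) m ∧
      (Phat k).C = selectC (2 * n + 1) p * O k ∧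
      (Phat k).D = h k k

/-- The noise `e` has Frobenius size at most `ε` on the Markov parameters `h(k, l)`,
`1 ≤ l ≤ k`, `2n+1 ≤ k ≤ N-2n+1`, which include all those that the algorithm reads. -/
def NoiseBounded {m p : ℕ} (n N : ℕ) (ε : ℝ) (e : ℕ → ℕ → Matrix (Fin p) (Fin m) ℝ) : Prop :=
  ∀ k l : ℕ, 1 ≤ l → l ≤ k → 2 * n + 1 ≤ k → k + 2 * n ≤ N + 1 → ‖e k l‖ ≤ ε

/-! Frobenius norm. -/

section Frobenius

variable {ι κ l : Type*} [Fintype ι] [Fintype κ] [Fintype l]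

/-! The Hankel matrix factors through the state at time `k` as observability times controllability
(`hankel_markov`). Minimality of the modes and the dwell time make both factors of rank `n` on
windows of length `2n`, so the noiseless Hankel matrix is a product of rank exactly `n`.

Individual singular vectors may be unstable under noise, since singular values can coincide. The
truncated product is stable: the first discarded singular value is at most the noise
(`discarded_singular_value_le`), so the noisy factors satisfy `Õ R̃ = Ô R̂ + O(ε)`. With `L` a left
inverse of `Ô`, the matrix `S = L Õ` satisfies `S R̃ - R̂ = L (Õ R̃ - Ô R̂)`, and also `Õ S⁻¹ - Ô =
O(ε)`. The output formulas are equivariant under this change of basis and locally Lipschitz, which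
gives the linear bounds on the quadruples.

Near orthogonality comes from balancing: `Γ = ÔᵀÔ = R̂R̂ᵀ`, and likewise for the noisy factors.
Eliminating the noisy Gramian yields `(S Sᵀ) Γ (S Sᵀ) = Γ + O(ε)`, whose exact version has `S Sᵀ =
1` as its only positive semidefinite solution. `frobenius_norm_sub_gram_mul_sq_le` makes this
quantitative, so that `ω` is even linear; `balanced_factor_perturbation` combines all this. -/

theorem frobenius_norm_sq (A : Matrix ι κ ℝ) : ‖A‖ ^ 2 = ∑ i, ∑ j, A i j ^ 2 := by
  rw [Matrix.frobenius_norm_def, ← Real.sqrt_eq_rpow, Real.sq_sqrt (by positivity)]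
  simp

theorem frobenius_norm_sq_eq_trace (A : Matrix ι κ ℝ) : ‖A‖ ^ 2 = trace (A * Aᵀ) := by
  rw [frobenius_norm_sq]
  simp [trace, Matrix.mul_apply, sq]

theorem abs_trace_mul_le (A : Matrix ι κ ℝ) (B : Matrix κ ι ℝ) :
    |trace (A * B)| ≤ ‖A‖ * ‖B‖ := by
  apply abs_le_of_sq_le_sq _ (by positivity)
  have h := Finset.sum_mul_sq_le_sq_mul_sq Finset.univ (fun x : ι × κ => A x.1 x.2)
    (fun x : ι × κ => Bᵀ x.1 x.2)
  rw [mul_pow, ← Matrix.frobenius_norm_transpose B, frobenius_norm_sq, frobenius_norm_sq]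
  simpa [Fintype.sum_prod_type, trace, Matrix.mul_apply] using h

theorem abs_apply_le_frobenius_norm (A : Matrix ι κ ℝ) (i : ι) (j : κ) : |A i j| ≤ ‖A‖ := by
  apply abs_le_of_sq_le_sq _ (norm_nonneg _)
  rw [frobenius_norm_sq]
  refine le_trans ?_ (Finset.single_le_sum (f := fun i => ∑ j, A i j ^ 2)
    (fun _ _ => by positivity) (Finset.mem_univ i))
  exact Finset.single_le_sum (f := fun j => A i j ^ 2) (fun _ _ => by positivity)
    (Finset.mem_univ j)

theorem frobenius_norm_le_of_forall_abs_le (A : Matrix ι κ ℝ) {r : ℝ} (hr : 0 ≤ r)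
    (h : ∀ i j, |A i j| ≤ r) : ‖A‖ ≤ Fintype.card ι * Fintype.card κ * r := by
  have h1 : ‖A‖ ^ 2 ≤ Fintype.card ι * Fintype.card κ * r ^ 2 := by
    rw [frobenius_norm_sq]
    calc ∑ i, ∑ j, A i j ^ 2 ≤ ∑ _i : ι, ∑ _j : κ, r ^ 2 := by
          refine Finset.sum_le_sum fun i _ => Finset.sum_le_sum fun j _ => ?_
          exact sq_le_sq' (abs_le.1 (h i j)).1 (abs_le.1 (h i j)).2
      _ = _ := by simp; ring
  -- A natural number is at most its square, which avoids square roots in the constants at the price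
  -- of sharpness.
  have h2 : (Fintype.card ι * Fintype.card κ : ℝ) ≤ (Fintype.card ι * Fintype.card κ : ℝ) ^ 2 := by
    exact_mod_cast Nat.le_self_pow two_ne_zero _
  refine (sq_le_sq₀ (norm_nonneg _) (by positivity)).1 ?_
  rw [mul_pow]
  exact h1.trans (by gcongr)

theorem frobenius_norm_mul_le {A : Matrix ι κ ℝ} {B : Matrix κ l ℝ} {a b : ℝ}
    (hA : ‖A‖ ≤ a) (hB : ‖B‖ ≤ b) : ‖A * B‖ ≤ a * b :=
  (Matrix.frobenius_norm_mul A B).trans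
    (mul_le_mul hA hB (norm_nonneg _) ((norm_nonneg _).trans hA))

theorem frobenius_norm_isometry_mul [DecidableEq κ] {Q : Matrix ι κ ℝ} (hQ : Qᵀ * Q = 1)
    (X : Matrix κ l ℝ) : ‖Q * X‖ = ‖X‖ := by
  have : ‖Q * X‖ ^ 2 = ‖X‖ ^ 2 := by
    rw [← Matrix.frobenius_norm_transpose, ← Matrix.frobenius_norm_transpose X,
      frobenius_norm_sq_eq_trace, frobenius_norm_sq_eq_trace]
    simp only [transpose_mul, transpose_transpose]
    rw [Matrix.mul_assoc, ← Matrix.mul_assoc Qᵀ, hQ, Matrix.one_mul]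
  exact (sq_eq_sq₀ (norm_nonneg _) (norm_nonneg _)).1 this

theorem frobenius_norm_le_card_of_isometry [DecidableEq κ] {Q : Matrix ι κ ℝ} (hQ : Qᵀ * Q = 1) :
    ‖Q‖ ≤ Fintype.card κ := by
  have h : ‖Q‖ ^ 2 = Fintype.card κ := by
    rw [frobenius_norm_sq_eq_trace, trace_mul_comm, hQ, trace_one]
  refine (sq_le_sq₀ (norm_nonneg _) (by positivity)).1 ?_
  rw [h]
  exact_mod_cast Nat.le_self_pow two_ne_zero _

theorem isUnit_one_add_of_frobenius_norm_lt_one [DecidableEq ι] {F : Matrix ι ι ℝ}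
    (hF : ‖F‖ < 1) : IsUnit (1 + F) := by
  rw [Matrix.isUnit_iff_isUnit_det, isUnit_iff_ne_zero]
  intro h0
  obtain ⟨v, hv, hv0⟩ := Matrix.exists_mulVec_eq_zero_iff.2 h0
  -- A kernel vector is viewed as a one-column matrix, so that submultiplicativity of the Frobenius
  -- norm applies directly.
  have h1 : replicateCol Unit v = -(F * replicateCol Unit v) := by
    rw [← replicateCol_mulVec]
    ext i j
    have := congrFun hv0 i
    simp [Matrix.add_mulVec] at this ⊢
    linarith
  have h2 : ‖replicateCol Unit v‖ ≤ ‖F‖ * ‖replicateCol Unit v‖ := by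
    conv_lhs => rw [h1, norm_neg]
    exact Matrix.frobenius_norm_mul _ _
  have h3 : 0 < ‖replicateCol Unit v‖ := by
    rw [norm_pos_iff]
    intro h
    exact hv (by ext i; exact congrFun (congrFun h i) ())
  nlinarith

/-- Lipschitz continuity of matrix inversion. -/
theorem frobenius_norm_inv_sub_inv_le [DecidableEq ι] {G K : Matrix ι ι ℝ} {M η : ℝ}
    (hG : IsUnit G.det) (hGM : ‖G⁻¹‖ ≤ M) (hKG : ‖K - G‖ ≤ η) (hη : 2 * M * η ≤ 1) :
    ‖K⁻¹‖ ≤ 2 * M ∧ ‖K⁻¹ - G⁻¹‖ ≤ 2 * M ^ 2 * η := by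
  have hM : 0 ≤ M := (norm_nonneg _).trans hGM
  have hη0 : 0 ≤ η := (norm_nonneg _).trans hKG
  have hF : ‖G⁻¹ * (K - G)‖ ≤ M * η := frobenius_norm_mul_le hGM hKG
  have hu := isUnit_one_add_of_frobenius_norm_lt_one (F := G⁻¹ * (K - G)) (by linarith)
  have hK : K = G * (1 + G⁻¹ * (K - G)) := by
    rw [Matrix.mul_add, Matrix.mul_nonsing_inv_cancel_left _ _ hG]; simp
  have hKu : IsUnit K.det := by
    rw [hK, Matrix.det_mul]
    exact hG.mul ((Matrix.isUnit_iff_isUnit_det _).1 hu)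
  have hdiff : K⁻¹ - G⁻¹ = -(G⁻¹ * (K - G) * K⁻¹) := by
    rw [Matrix.mul_sub, Matrix.sub_mul, Matrix.mul_assoc, Matrix.mul_nonsing_inv _ hKu,
      Matrix.nonsing_inv_mul _ hG]
    simp
  have h1 : ‖K⁻¹ - G⁻¹‖ ≤ M * η * ‖K⁻¹‖ := by
    rw [hdiff, norm_neg]
    exact frobenius_norm_mul_le hF le_rfl
  -- Since `M * η ≤ 1 / 2`, the term `M * η * ‖K⁻¹‖` is absorbed on the left.
  have h2 : ‖K⁻¹‖ ≤ 2 * M := by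
    have h3 : ‖K⁻¹‖ ≤ ‖K⁻¹ - G⁻¹‖ + ‖G⁻¹‖ := by
      simpa using norm_add_le (K⁻¹ - G⁻¹) G⁻¹
    nlinarith [norm_nonneg K⁻¹]
  refine ⟨h2, h1.trans ?_⟩
  calc M * η * ‖K⁻¹‖ ≤ M * η * (2 * M) := by gcongr
    _ = _ := by ring

end Frobenius

/-! The left inverse `(XᵀX)⁻¹Xᵀ`. -/

section LeftInv

variable {ι : Type} [Fintype ι] {n : ℕ}

/-- This equivariance shows that conjugating the estimated `A` by the change of basis amounts to
running the same formula on the transformed observability factors. -/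
theorem leftInv_mul_inv (X : Matrix ι (Fin n) ℝ) {T : Matrix (Fin n) (Fin n) ℝ}
    (hT : IsUnit T.det) : leftInv (X * T⁻¹) = T * leftInv X := by
  have hTt : IsUnit (Tᵀ).det := by rwa [det_transpose]
  unfold leftInv
  rw [transpose_mul, show (T⁻¹)ᵀ * Xᵀ * (X * T⁻¹) = (Tᵀ)⁻¹ * (Xᵀ * X) * T⁻¹ by
    rw [transpose_nonsing_inv]; simp only [Matrix.mul_assoc]]
  rw [Matrix.mul_inv_rev, Matrix.mul_inv_rev, nonsing_inv_nonsing_inv _ hT,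
    nonsing_inv_nonsing_inv _ hTt, transpose_nonsing_inv]
  rw [Matrix.mul_assoc T, Matrix.mul_assoc _ Tᵀ, Matrix.mul_nonsing_inv_cancel_left _ _ hTt]

theorem isUnit_det_gram {X : Matrix ι (Fin n) ℝ} {L : Matrix (Fin n) ι ℝ} (hL : L * X = 1) :
    IsUnit (Xᵀ * X).det := by
  rw [isUnit_iff_ne_zero]
  intro h0
  obtain ⟨v, hv, hv0⟩ := Matrix.exists_mulVec_eq_zero_iff.2 h0
  have h1 : X *ᵥ v = 0 := by
    rw [← Matrix.mulVec_mulVec] at hv0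
    have : (X *ᵥ v) ⬝ᵥ (X *ᵥ v) = 0 := by
      rw [Matrix.dotProduct_mulVec, Matrix.vecMul_mulVec, ← Matrix.dotProduct_mulVec]
      rw [← Matrix.mulVec_mulVec, hv0, dotProduct_zero]
    exact dotProduct_self_eq_zero.1 this
  apply hv
  rw [← Matrix.one_mulVec v, ← hL, ← Matrix.mulVec_mulVec, h1, Matrix.mulVec_zero]

/-- `X * leftInv X` is the orthogonal projection onto the range of `X`, of Frobenius norm `√n`, and
`leftInv X = L * (X * leftInv X)`. The Gram inverse is `leftInv X` times its transpose. -/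
theorem frobenius_norm_gram_inv_le {X : Matrix ι (Fin n) ℝ} {L : Matrix (Fin n) ι ℝ}
    (hL : L * X = 1) : ‖(Xᵀ * X)⁻¹‖ ≤ (n * ‖L‖) ^ 2 := by
  have hu := isUnit_det_gram hL
  have h1 : leftInv X * X = 1 := by
    unfold leftInv
    rw [Matrix.mul_assoc, Matrix.nonsing_inv_mul _ hu]
  have h2 : (leftInv X) * (leftInv X)ᵀ = (Xᵀ * X)⁻¹ := by
    unfold leftInv
    rw [transpose_mul, transpose_transpose, transpose_nonsing_inv, transpose_mul,
      transpose_transpose, Matrix.mul_assoc, ← Matrix.mul_assoc Xᵀ,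
      Matrix.mul_nonsing_inv _ hu, Matrix.mul_one]
  have hsym : (X * leftInv X)ᵀ = X * leftInv X := by
    unfold leftInv
    simp only [transpose_mul, transpose_transpose, transpose_nonsing_inv, Matrix.mul_assoc]
  have h3 : ‖X * leftInv X‖ ≤ n := by
    have h : ‖X * leftInv X‖ ^ 2 = n := by
      rw [frobenius_norm_sq_eq_trace, hsym, Matrix.mul_assoc, ← Matrix.mul_assoc (leftInv X), h1,
        Matrix.one_mul, trace_mul_comm, h1]
      simp
    refine (sq_le_sq₀ (norm_nonneg _) (by positivity)).1 ?_
    rw [h]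
    exact_mod_cast Nat.le_self_pow two_ne_zero _
  have h4 : ‖leftInv X‖ ≤ n * ‖L‖ := by
    have : leftInv X = L * (X * leftInv X) := by
      rw [← Matrix.mul_assoc, hL, Matrix.one_mul]
    rw [this, mul_comm]
    exact frobenius_norm_mul_le le_rfl h3
  rw [← h2, sq]
  exact frobenius_norm_mul_le h4 (by rwa [Matrix.frobenius_norm_transpose])

/-- Lipschitz continuity of the left inverse at matrices of full column rank. -/
theorem leftInv_lipschitz (n : ℕ) {M : ℝ} (hM : 1 ≤ M) : ∃ C : ℝ, 1 ≤ C ∧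
    ∀ {ι : Type} [Fintype ι] {X Y : Matrix ι (Fin n) ℝ} {L : Matrix (Fin n) ι ℝ} {η : ℝ},
      L * X = 1 → ‖L‖ ≤ M → ‖X‖ ≤ M → ‖Y - X‖ ≤ η → C * η ≤ 1 →
      ‖leftInv X‖ ≤ C ∧ ‖leftInv Y - leftInv X‖ ≤ C * η := by
  obtain ⟨g, hg⟩ : ∃ g : ℝ, g = (n * M) ^ 2 := ⟨_, rfl⟩
  have hg0 : 0 ≤ g := by rw [hg]; positivity
  -- The summands serve, in order: `η ≤ 1`, the size of `leftInv X`, the smallness needed to invert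
  -- the perturbed Gram matrix, and (the last two) the difference of the left inverses.
  refine ⟨1 + g * M + 6 * g * M + 2 * g + 6 * g ^ 2 * M ^ 2,
    by nlinarith [mul_nonneg hg0 (zero_le_one.trans hM), sq_nonneg (g * M)], ?_⟩
  intro ι _ X Y L η hL hLM hX hYX hC
  have hη : 0 ≤ η := (norm_nonneg _).trans hYX
  have hgM : 0 ≤ g * M := mul_nonneg hg0 (by linarith)
  have hgM2 : 0 ≤ 6 * g ^ 2 * M ^ 2 := by positivity
  have hη1 : η ≤ 1 := by
    nlinarith
  have hGi : ‖(Xᵀ * X)⁻¹‖ ≤ g := by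
    refine (frobenius_norm_gram_inv_le hL).trans ?_
    rw [hg]; gcongr
  have hY : ‖Y‖ ≤ 2 * M := by
    have := norm_add_le (Y - X) X
    simp only [sub_add_cancel] at this
    linarith
  have hXt : ‖Xᵀ‖ ≤ M := by rwa [Matrix.frobenius_norm_transpose]
  have hYt : ‖Yᵀ‖ ≤ 2 * M := by rwa [Matrix.frobenius_norm_transpose]
  have hYXt : ‖Yᵀ - Xᵀ‖ ≤ η := by rwa [← transpose_sub, Matrix.frobenius_norm_transpose]
  have hK : ‖Yᵀ * Y - Xᵀ * X‖ ≤ 3 * M * η := by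
    have : Yᵀ * Y - Xᵀ * X = (Yᵀ - Xᵀ) * Y + Xᵀ * (Y - X) := by
      rw [Matrix.sub_mul, Matrix.mul_sub]; abel
    rw [this]
    refine (norm_add_le _ _).trans ?_
    have h1 := frobenius_norm_mul_le hYXt hY
    have h2 := frobenius_norm_mul_le hXt hYX
    linarith
  obtain ⟨hKi, hd⟩ := frobenius_norm_inv_sub_inv_le (isUnit_det_gram hL) hGi hK (by nlinarith)
  constructor
  · have := frobenius_norm_mul_le hGi hXt
    unfold leftInv
    nlinarith
  · have : leftInv Y - leftInv X =
        ((Yᵀ * Y)⁻¹ - (Xᵀ * X)⁻¹) * Xᵀ + (Yᵀ * Y)⁻¹ * (Yᵀ - Xᵀ) := by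
      unfold leftInv
      rw [Matrix.sub_mul, Matrix.mul_sub]; abel
    rw [this]
    refine (norm_add_le _ _).trans ?_
    have h1 := frobenius_norm_mul_le hd hXt
    have h2 := frobenius_norm_mul_le hKi hYXt
    have h3 : 0 ≤ (1 + g * M + 6 * g * M) * η := by
      have : 0 ≤ 6 * g * M := by linarith
      positivity
    nlinarith

end LeftInv

/-! Perturbation of balanced factorizations. -/

section Balanced

variable {ι κ : Type} [Fintype ι] [Fintype κ] {n : ℕ}

/-- A quantitative form of the injectivity of squaring on positive semidefinite matrices. For `X = A
* Aᵀ` and `Y = B * Bᵀ`, `tr((X-Y)(X²-Y²))` is the sum of `tr((X-Y)X(X-Y))` and `tr((X-Y)Y(X-Y))`;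
both are nonnegative, the second is the left-hand side, and Cauchy–Schwarz bounds the sum. -/
theorem frobenius_norm_sub_gram_mul_sq_le (A B : Matrix ι κ ℝ) :
    ‖(A * Aᵀ - B * Bᵀ) * B‖ ^ 2 ≤
      ‖A * Aᵀ - B * Bᵀ‖ * ‖A * Aᵀ * (A * Aᵀ) - B * Bᵀ * (B * Bᵀ)‖ := by
  have hs : ∀ Z : Matrix ι κ ℝ, ‖(A * Aᵀ - B * Bᵀ) * Z‖ ^ 2 =
      trace ((A * Aᵀ - B * Bᵀ) * (Z * Zᵀ) * (A * Aᵀ - B * Bᵀ)) := by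
    intro Z
    rw [frobenius_norm_sq_eq_trace]
    simp only [transpose_mul, transpose_sub, transpose_transpose, Matrix.mul_assoc]
  have hA := hs A
  have hB := hs B
  have h0 : 0 ≤ ‖(A * Aᵀ - B * Bᵀ) * A‖ ^ 2 := by positivity
  generalize A * Aᵀ = X at *
  generalize B * Bᵀ = Y at *
  have ht : trace ((X - Y) * (X * X - Y * Y)) =
      trace ((X - Y) * X * (X - Y)) + trace ((X - Y) * Y * (X - Y)) := by
    have h1 := trace_mul_cycle X X Y
    have h2 := trace_mul_cycle X Y X
    have h3 := trace_mul_cycle X Y Y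
    have h4 := trace_mul_cycle Y X Y
    simp only [Matrix.mul_sub, Matrix.sub_mul, trace_sub, ← Matrix.mul_assoc] at *
    linarith
  have := le_abs_self (trace ((X - Y) * (X * X - Y * Y)))
  have := abs_trace_mul_le (X - Y) (X * X - Y * Y)
  linarith

/-- Two balanced factorizations `Oh * Rh` and `Ot * Rt` of nearby matrices differ by a nearly
orthogonal change of basis, which is `L * Ot` for any left inverse `L` of `Oh`. -/
theorem balanced_factor_perturbation {M : ℝ} (hM : 1 ≤ M)
    {Oh Ot : Matrix ι (Fin n) ℝ} {Rh Rt : Matrix (Fin n) κ ℝ} {L : Matrix (Fin n) ι ℝ}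
    {G : Matrix κ (Fin n) ℝ} {Z : Matrix (Fin n) (Fin n) ℝ} {η : ℝ}
    (hL : L * Oh = 1) (hG : Rh * G = 1) (hZ : Ohᵀ * Oh * Z = 1)
    (hbal : Ohᵀ * Oh = Rh * Rhᵀ) (hbalt : Otᵀ * Ot = Rt * Rtᵀ)
    (hOhM : ‖Oh‖ ≤ M) (hOtM : ‖Ot‖ ≤ M) (hRhM : ‖Rh‖ ≤ M) (hRtM : ‖Rt‖ ≤ M) (hLM : ‖L‖ ≤ M)
    (hGM : ‖G‖ ≤ M) (hZM : ‖Z‖ ≤ M) (hη : ‖Ot * Rt - Oh * Rh‖ ≤ η) (hC : 16 * M ^ 26 * η ≤ 1) :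
    IsUnit (L * Ot).det ∧ ‖L * Ot‖ ≤ 16 * M ^ 26 ∧ ‖(L * Ot)⁻¹‖ ≤ 16 * M ^ 26 ∧
      ‖L * Ot * Rt - Rh‖ ≤ 16 * M ^ 26 * η ∧ ‖Ot * (L * Ot)⁻¹ - Oh‖ ≤ 16 * M ^ 26 * η ∧
      ‖(L * Ot)ᵀ * (L * Ot) - 1‖ ≤ 16 * M ^ 26 * η := by
  have hη0 : 0 ≤ η := (norm_nonneg _).trans hη
  have hM0 : 0 ≤ M := by linarith
  -- The worst case, at the end, is `S⁻¹ * (S * Sᵀ - 1) * S`, bounded by `2M² · 8M²²η · M² =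
  -- 16M²⁶η`.
  have hpow : ∀ k, k ≤ 26 → M ^ k ≤ M ^ 26 := fun k hk => pow_le_pow_right₀ hM hk
  have hpow0 : 0 ≤ M ^ 26 := by positivity
  have hbound : ∀ (k : ℕ) (a : ℝ), 0 ≤ a → a ≤ 16 → k ≤ 26 → a * M ^ k * η ≤ 16 * M ^ 26 * η := by
    intro k a ha ha' hk
    have := hpow k hk
    gcongr
  set S := L * Ot with hS
  have hSM : ‖S‖ ≤ M ^ 2 := (frobenius_norm_mul_le hLM hOtM).trans_eq (by ring)
  have hStM : ‖Sᵀ‖ ≤ M ^ 2 := by rwa [Matrix.frobenius_norm_transpose]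
  -- the input side
  have hSR : S * Rt - Rh = L * (Ot * Rt - Oh * Rh) := by
    rw [Matrix.mul_sub, ← Matrix.mul_assoc L Oh, hL, Matrix.one_mul, hS, Matrix.mul_assoc]
  have hSRn : ‖S * Rt - Rh‖ ≤ M * η := by
    rw [hSR]; exact frobenius_norm_mul_le hLM hη
  -- invertibility
  set F := (S * Rt - Rh) * G with hF
  have hFn : ‖F‖ ≤ M ^ 2 * η := (frobenius_norm_mul_le hSRn hGM).trans_eq (by ring)
  have hF2 : ‖F‖ ≤ 1 / 2 := by
    have h2 := hbound 2 2 (by norm_num) (by norm_num) (by norm_num)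
    linarith
  -- `Rt * G` is an approximate right inverse of `S`, because `S * Rt` is close to `Rh` and `Rh * G
  -- = 1`.
  have hSK : S * (Rt * G) = 1 + F := by
    rw [hF, Matrix.sub_mul, hG, ← Matrix.mul_assoc]; abel
  have hKM : ‖Rt * G‖ ≤ M ^ 2 := (frobenius_norm_mul_le hRtM hGM).trans_eq (by ring)
  have hSu : IsUnit S.det := by
    have h1 := (Matrix.isUnit_iff_isUnit_det _).1
      (isUnit_one_add_of_frobenius_norm_lt_one (F := F) (by linarith))
    rw [← hSK, Matrix.det_mul] at h1
    exact isUnit_of_mul_isUnit_left h1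
  have hSi : S⁻¹ = Rt * G - S⁻¹ * F := by
    have : S⁻¹ * (S * (Rt * G)) = S⁻¹ * (1 + F) := by rw [hSK]
    rw [Matrix.nonsing_inv_mul_cancel_left _ _ hSu, Matrix.mul_add, Matrix.mul_one] at this
    rw [this]; abel
  have hSiM : ‖S⁻¹‖ ≤ 2 * M ^ 2 := by
    have h1 : ‖S⁻¹‖ ≤ ‖Rt * G‖ + ‖S⁻¹ * F‖ := by
      conv_lhs => rw [hSi]
      exact norm_sub_le _ _
    have h2 := frobenius_norm_mul_le (le_refl ‖S⁻¹‖) hF2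
    linarith
  -- the output side
  have hOS : Ot * S⁻¹ - Oh = (Ot * Rt - Oh * Rh) * G - Ot * S⁻¹ * F := by
    have h1 : Ot * S⁻¹ = Ot * (Rt * G) - Ot * S⁻¹ * F := by
      conv_lhs => rw [hSi]
      rw [Matrix.mul_sub, Matrix.mul_assoc]
    rw [Matrix.sub_mul, Matrix.mul_assoc Oh, hG, Matrix.mul_one]
    conv_lhs => rw [h1]
    rw [Matrix.mul_assoc Ot Rt]; abel
  have hOSn : ‖Ot * S⁻¹ - Oh‖ ≤ 3 * M ^ 5 * η := by
    rw [hOS]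
    refine (norm_sub_le _ _).trans ?_
    have h1 := frobenius_norm_mul_le hη hGM
    have h2 := frobenius_norm_mul_le (frobenius_norm_mul_le hOtM hSiM) hFn
    have h3 : M ^ 1 * η ≤ M ^ 5 * η := by gcongr; norm_num
    rw [pow_one] at h3
    calc _ ≤ η * M + M * (2 * M ^ 2) * (M ^ 2 * η) := add_le_add h1 h2
      _ ≤ M ^ 5 * η + 2 * (M ^ 5 * η) := by
        have : M * (2 * M ^ 2) * (M ^ 2 * η) = 2 * (M ^ 5 * η) := by ring
        linarith
      _ = _ := by ring
  -- near equality of the Gramians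
  have hΔ : Ot - Oh * S = (Ot * S⁻¹ - Oh) * S := by
    rw [Matrix.sub_mul, Matrix.nonsing_inv_mul_cancel_right _ _ hSu]
  have hΔn : ‖Ot - Oh * S‖ ≤ 3 * M ^ 7 * η := by
    rw [hΔ]
    exact (frobenius_norm_mul_le hOSn hSM).trans_eq (by ring)
  have hOhS : ‖Oh * S‖ ≤ M ^ 3 := (frobenius_norm_mul_le hOhM hSM).trans_eq (by ring)
  have hg1 : ‖Sᵀ * (Ohᵀ * Oh) * S - Otᵀ * Ot‖ ≤ 6 * M ^ 10 * η := by
    have h1 : Sᵀ * (Ohᵀ * Oh) * S - Otᵀ * Ot =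
        -((Ot - Oh * S)ᵀ * Ot + (Oh * S)ᵀ * (Ot - Oh * S)) := by
      simp only [transpose_sub, transpose_mul, Matrix.sub_mul, Matrix.mul_sub, Matrix.mul_assoc]
      abel
    rw [h1, norm_neg]
    refine (norm_add_le _ _).trans ?_
    have h2 := frobenius_norm_mul_le
      (A := (Ot - Oh * S)ᵀ) ((Matrix.frobenius_norm_transpose _).trans_le hΔn) hOtM
    have h3 := frobenius_norm_mul_le
      (A := (Oh * S)ᵀ) ((Matrix.frobenius_norm_transpose _).trans_le hOhS) hΔn
    have h4 : M ^ 8 * η ≤ M ^ 10 * η := by gcongr; norm_num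
    calc _ ≤ 3 * M ^ 7 * η * M + M ^ 3 * (3 * M ^ 7 * η) := add_le_add h2 h3
      _ = 3 * (M ^ 8 * η) + 3 * M ^ 10 * η := by ring
      _ ≤ _ := by linarith
  have hSRt : ‖S * Rt‖ ≤ M ^ 3 := (frobenius_norm_mul_le hSM hRtM).trans_eq (by ring)
  have hg2 : ‖S * (Rt * Rtᵀ) * Sᵀ - Rh * Rhᵀ‖ ≤ 2 * M ^ 4 * η := by
    have h1 : S * (Rt * Rtᵀ) * Sᵀ - Rh * Rhᵀ =
        (S * Rt - Rh) * (S * Rt)ᵀ + Rh * (S * Rt - Rh)ᵀ := by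
      simp only [transpose_sub, transpose_mul, Matrix.sub_mul, Matrix.mul_sub, Matrix.mul_assoc]
      abel
    rw [h1]
    refine (norm_add_le _ _).trans ?_
    have h2 := frobenius_norm_mul_le hSRn
      (B := (S * Rt)ᵀ) ((Matrix.frobenius_norm_transpose _).trans_le hSRt)
    have h3 := frobenius_norm_mul_le hRhM
      (B := (S * Rt - Rh)ᵀ) ((Matrix.frobenius_norm_transpose _).trans_le hSRn)
    have h4 : M ^ 2 * η ≤ M ^ 4 * η := by gcongr; norm_num
    calc _ ≤ M * η * M ^ 3 + M * (M * η) := add_le_add h2 h3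
      _ = M ^ 4 * η + M ^ 2 * η := by ring
      _ ≤ _ := by linarith
  set Γ := Ohᵀ * Oh with hΓ
  -- Balancing identifies `Otᵀ * Ot` with `Rt * Rtᵀ`, so the noisy Gramian is eliminated between the
  -- two preceding estimates.
  have hg3 : ‖S * Sᵀ * Γ * (S * Sᵀ) - Γ‖ ≤ 8 * M ^ 14 * η := by
    have h1 : S * Sᵀ * Γ * (S * Sᵀ) - Γ =
        S * (Sᵀ * Γ * S - Otᵀ * Ot) * Sᵀ + (S * (Rt * Rtᵀ) * Sᵀ - Rh * Rhᵀ) := by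
      rw [← hbal, ← hbalt]
      simp only [Matrix.sub_mul, Matrix.mul_sub, Matrix.mul_assoc]
      abel
    rw [h1]
    refine (norm_add_le _ _).trans ?_
    have h2 := frobenius_norm_mul_le (frobenius_norm_mul_le hSM hg1) hStM
    have h4 : M ^ 4 * η ≤ M ^ 14 * η := by gcongr; norm_num
    calc _ ≤ M ^ 2 * (6 * M ^ 10 * η) * M ^ 2 + 2 * M ^ 4 * η := add_le_add h2 hg2
      _ = 6 * M ^ 14 * η + 2 * (M ^ 4 * η) := by ring
      _ ≤ _ := by linarith
  -- near orthogonality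
  have hOht : ‖Ohᵀ‖ ≤ M := by rwa [Matrix.frobenius_norm_transpose]
  have hD : ‖S * Sᵀ - 1‖ ≤ 8 * M ^ 22 * η := by
    -- With this choice the difference of squares is `Oh (S Sᵀ Γ S Sᵀ - Γ) Ohᵀ`, already known to be
    -- small.
    have key := frobenius_norm_sub_gram_mul_sq_le (Oh * S) Oh
    have e1 : Oh * S * (Oh * S)ᵀ - Oh * Ohᵀ = Oh * (S * Sᵀ - 1) * Ohᵀ := by
      simp only [transpose_mul, Matrix.sub_mul, Matrix.mul_sub, Matrix.mul_assoc, Matrix.one_mul]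
    have e2 : Oh * S * (Oh * S)ᵀ * (Oh * S * (Oh * S)ᵀ) - Oh * Ohᵀ * (Oh * Ohᵀ) =
        Oh * (S * Sᵀ * Γ * (S * Sᵀ) - Γ) * Ohᵀ := by
      simp only [hΓ, transpose_mul, Matrix.sub_mul, Matrix.mul_sub, Matrix.mul_assoc]
    rw [e2, e1] at key
    have e3 : S * Sᵀ - 1 = L * (Oh * (S * Sᵀ - 1) * Ohᵀ * Oh) * Z := by
      have : L * (Oh * (S * Sᵀ - 1) * Ohᵀ * Oh) * Z = (L * Oh) * (S * Sᵀ - 1) * (Γ * Z) := by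
        simp only [hΓ, Matrix.mul_assoc]
      rw [this, hL, hZ, Matrix.one_mul, Matrix.mul_one]
    have h1 := frobenius_norm_mul_le (frobenius_norm_mul_le hLM
      (le_refl ‖Oh * (S * Sᵀ - 1) * Ohᵀ * Oh‖)) hZM
    rw [← e3] at h1
    have h2 := frobenius_norm_mul_le (frobenius_norm_mul_le hOhM (le_refl ‖S * Sᵀ - 1‖)) hOht
    have h3 := frobenius_norm_mul_le (frobenius_norm_mul_le hOhM hg3) hOht
    set δ := ‖S * Sᵀ - 1‖ with hδ
    have hδ0 : 0 ≤ δ := norm_nonneg _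
    -- One factor `δ` on the right can be cancelled, so the rate is linear in `η` rather than of
    -- order `√η`.
    have h4 : δ ^ 2 ≤ δ * (8 * M ^ 22 * η) := by
      calc δ ^ 2 ≤ (M * ‖Oh * (S * Sᵀ - 1) * Ohᵀ * Oh‖ * M) ^ 2 := by gcongr
        _ = M ^ 4 * ‖Oh * (S * Sᵀ - 1) * Ohᵀ * Oh‖ ^ 2 := by ring
        _ ≤ M ^ 4 * ((M * δ * M) * (M * (8 * M ^ 14 * η) * M)) := by
          gcongr
          exact key.trans (mul_le_mul h2 h3 (norm_nonneg _) (by positivity))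
        _ = _ := by ring
    rcases hδ0.eq_or_lt with h | h
    · rw [← h]; positivity
    · rw [sq] at h4
      exact le_of_mul_le_mul_left h4 h
  have hD' : ‖Sᵀ * S - 1‖ ≤ 16 * M ^ 26 * η := by
    have h1 : Sᵀ * S - 1 = S⁻¹ * (S * Sᵀ - 1) * S := by
      rw [Matrix.mul_sub, Matrix.nonsing_inv_mul_cancel_left _ _ hSu, Matrix.sub_mul,
        Matrix.mul_one, Matrix.nonsing_inv_mul _ hSu]
    rw [h1]
    exact (frobenius_norm_mul_le (frobenius_norm_mul_le hSiM hD) hSM).trans_eq (by ring)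
  have h2 := hpow 2 (by norm_num)
  refine ⟨hSu, by linarith, by linarith, ?_, ?_, hD'⟩
  · have := hbound 1 1 (by norm_num) (by norm_num) (by norm_num)
    rw [pow_one, one_mul] at this
    exact hSRn.trans this
  · exact hOSn.trans (hbound 5 3 (by norm_num) (by norm_num) (by norm_num))

end Balanced

/-! Truncated singular value decompositions. -/

section SVD

variable {ι κ : Type} [Fintype ι] [Fintype κ] {n : ℕ}

theorem fromCols_isometry {l : Type*} {a : ℕ} {U : Matrix l (Fin n) ℝ} {Ue : Matrix l (Fin a) ℝ}
    [Fintype l] (h : (fromCols U Ue)ᵀ * fromCols U Ue = 1) :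
    Uᵀ * U = 1 ∧ Uᵀ * Ue = 0 ∧ Ueᵀ * U = 0 ∧ Ueᵀ * Ue = 1 := by
  rw [transpose_fromCols, fromRows_mul_fromCols, ← fromBlocks_one, fromBlocks_inj] at h
  exact h

/-- The first discarded singular value of a perturbation of a matrix of rank at most `n` is at
most the size of the perturbation. -/
theorem discarded_singular_value_le {a b : ℕ} {O : Matrix ι (Fin n) ℝ} {R : Matrix (Fin n) κ ℝ}
    {E : Matrix ι κ ℝ} {Q : Matrix ι (Fin n ⊕ Fin (a + 1)) ℝ}
    {W : Matrix κ (Fin n ⊕ Fin (b + 1)) ℝ} {s : Fin n → ℝ} {t : ℕ → ℝ}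
    (hQ : Qᵀ * Q = 1) (hW : Wᵀ * W = 1) (hts : ∀ i, t 0 ≤ s i) (ht : 0 ≤ t 0)
    (hH : O * R + E = Q * fromBlocks (diagonal s) 0 0
      (Matrix.of fun (i : Fin (a + 1)) (j : Fin (b + 1)) =>
        if (i : ℕ) = (j : ℕ) then t i else 0) * Wᵀ) :
    t 0 ≤ ‖E‖ := by
  set D := fromBlocks (diagonal s) 0 0
      (Matrix.of fun (i : Fin (a + 1)) (j : Fin (b + 1)) =>
        if (i : ℕ) = (j : ℕ) then t i else 0) with hD
  -- `v` embeds, in singular coordinates, the span of the `n` leading right singular vectors and the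
  -- first discarded one. As `R` has only `n` rows, some nonzero vector of this `(n+1)`-dimensional
  -- space is killed by `R`; on it the perturbed matrix acts as `E`, while it stretches by at least
  -- `t 0`.
  let v : (Fin n → ℝ) × ℝ →ₗ[ℝ] (Fin n ⊕ Fin (b + 1) → ℝ) :=
    { toFun := fun x => Sum.elim x.1 (Pi.single 0 x.2)
      map_add' := by
        intro x y
        ext i
        rcases i with i | i
        · simp
        · simp [Pi.single_add]
      map_smul' := by
        intro c x
        ext i
        rcases i with i | i
        · simp
        · rcases eq_or_ne i 0 with rfl | h
          · simp
          · simp [Pi.single_eq_of_ne h] }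
  let f : (Fin n → ℝ) × ℝ →ₗ[ℝ] (Fin n → ℝ) := (R * W).mulVecLin ∘ₗ v
  have hker : LinearMap.ker f ≠ ⊥ := by
    apply LinearMap.ker_ne_bot_of_finrank_lt
    simp
  obtain ⟨x, hx, hx0⟩ := Submodule.exists_mem_ne_zero_of_ne_bot hker
  have hfx : (R * W) *ᵥ v x = 0 := hx
  set X := replicateCol Unit (v x) with hX
  have hRX : R * W * X = 0 := by
    rw [hX, ← replicateCol_mulVec, hfx]; rfl
  have hEX : ‖D * X‖ ≤ ‖E‖ * ‖X‖ := by
    have h1 : Q * (D * X) = E * (W * X) := by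
      have h2 : (O * R + E) * (W * X) = Q * (D * X) := by
        rw [hH]
        simp only [Matrix.mul_assoc]
        rw [← Matrix.mul_assoc Wᵀ, hW, Matrix.one_mul]
      rw [← h2, Matrix.add_mul, Matrix.mul_assoc O, ← Matrix.mul_assoc R, hRX]
      simp
    rw [← frobenius_norm_isometry_mul hQ, h1, ← frobenius_norm_isometry_mul hW X]
    exact Matrix.frobenius_norm_mul _ _
  have hXn : ‖X‖ ^ 2 = ∑ i, x.1 i ^ 2 + x.2 ^ 2 := by
    rw [frobenius_norm_sq]
    simp [hX, v, Pi.single_apply, ite_pow]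
  have hDXe : D *ᵥ v x = Sum.elim (fun i => s i * x.1 i) (Pi.single 0 (t 0 * x.2)) := by
    have : v x = Sum.elim x.1 (Pi.single 0 x.2) := rfl
    rw [this, hD, fromBlocks_mulVec]
    congr 1
    · ext i; simp [Matrix.mulVec_diagonal]
    · ext i
      rcases eq_or_ne i 0 with rfl | h
      · simp [mul_comm]
      · have h' : (i : ℕ) ≠ 0 := fun h0 => h (Fin.ext h0)
        simp [h, h']
  have hDX : ‖D * X‖ ^ 2 = ∑ i, (s i * x.1 i) ^ 2 + (t 0 * x.2) ^ 2 := by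
    rw [hX, ← replicateCol_mulVec, hDXe, frobenius_norm_sq]
    simp [Pi.single_apply, ite_pow]
  have hlow : t 0 * ‖X‖ ≤ ‖D * X‖ := by
    refine (sq_le_sq₀ (by positivity) (norm_nonneg _)).1 ?_
    rw [mul_pow, hXn, hDX, mul_add, Finset.mul_sum, mul_pow]
    gcongr with i _
    rw [mul_pow]
    have := hts i
    gcongr
  have hXpos : 0 < ‖X‖ := by
    rw [norm_pos_iff]
    intro h
    have hn : ‖X‖ ^ 2 = 0 := by rw [h]; simp
    rw [hXn] at hn
    have h1 : 0 ≤ ∑ i, x.1 i ^ 2 := Finset.sum_nonneg fun _ _ => by positivity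
    have h2 : ∑ i, x.1 i ^ 2 = 0 := by nlinarith [sq_nonneg x.2]
    have h3 : x.2 = 0 := by nlinarith [sq_nonneg x.2]
    apply hx0
    refine Prod.ext ?_ h3
    ext i
    have := (Finset.sum_eq_zero_iff_of_nonneg (fun _ _ => by positivity)).1 h2 i (Finset.mem_univ i)
    simpa using this
  exact le_of_mul_le_mul_right (hlow.trans hEX) hXpos

theorem card_eq_of_orthogonal [DecidableEq ι] {a : ℕ} {Q : Matrix ι (Fin n ⊕ Fin a) ℝ} (h1 : Qᵀ * Q = 1)
    (h2 : Q * Qᵀ = 1) : n + a = Fintype.card ι := by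
  have := square_of_invertible Qᵀ Q h1 h2
  simpa using this

variable [DecidableEq ι] [DecidableEq κ]

/-- The truncated singular value decomposition of a perturbation of a matrix of rank at most `n`
is close to the perturbed matrix. -/
theorem IsLeadingSVD.norm_sub_le {O : Matrix ι (Fin n) ℝ} {R : Matrix (Fin n) κ ℝ}
    {E : Matrix ι κ ℝ} {U : Matrix ι (Fin n) ℝ} {s : Fin n → ℝ} {V : Matrix κ (Fin n) ℝ}
    (h : IsLeadingSVD (O * R + E) U s V) :
    ‖O * R + E - U * diagonal s * Vᵀ‖ ≤
      (Fintype.card ι * Fintype.card κ : ℝ) ^ 2 * ‖E‖ := by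
  obtain ⟨a, b, Ue, Ve, t, hU, hU', hV, hV', -, ht, hts, ht0, hH⟩ := h
  have ha := card_eq_of_orthogonal hU hU'
  have hb := card_eq_of_orthogonal hV hV'
  set T := Matrix.of fun (i : Fin a) (j : Fin b) => if (i : ℕ) = (j : ℕ) then t i else 0 with hT
  have hsplit : O * R + E - U * diagonal s * Vᵀ = Ue * T * Veᵀ := by
    rw [hH, fromCols_mul_fromBlocks, transpose_fromCols, fromCols_mul_fromRows]
    simp
  have haι : (a : ℝ) ≤ Fintype.card ι := by exact_mod_cast (by omega)
  have hbκ : (b : ℝ) ≤ Fintype.card κ := by exact_mod_cast (by omega)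
  have hUe : ‖Ue‖ ≤ Fintype.card ι := by
    have := frobenius_norm_le_card_of_isometry (fromCols_isometry hU).2.2.2
    simp only [Fintype.card_fin] at this
    linarith
  have hVe : ‖Veᵀ‖ ≤ Fintype.card κ := by
    have := frobenius_norm_le_card_of_isometry (fromCols_isometry hV).2.2.2
    rw [Matrix.frobenius_norm_transpose]
    simp only [Fintype.card_fin] at this
    linarith
  have hTE : ∀ i j, |T i j| ≤ ‖E‖ := by
    intro i j
    -- The mere existence of an entry makes both dimensions positive, so that `t 0` really is a
    -- discarded singular value.
    obtain ⟨a, rfl⟩ := Nat.exists_eq_succ_of_ne_zero (Nat.pos_iff_ne_zero.1 i.pos)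
    obtain ⟨b, rfl⟩ := Nat.exists_eq_succ_of_ne_zero (Nat.pos_iff_ne_zero.1 j.pos)
    have h0 := discarded_singular_value_le hU hV (fun i => hts i 0) (ht0 0) hH
    simp only [hT, Matrix.of_apply]
    split_ifs
    · rw [abs_of_nonneg (ht0 _)]
      exact (ht (Nat.zero_le _)).trans h0
    · simp
  have hTn := frobenius_norm_le_of_forall_abs_le T (norm_nonneg E) hTE
  simp only [Fintype.card_fin] at hTn
  have hTn' : ‖T‖ ≤ Fintype.card ι * Fintype.card κ * ‖E‖ := hTn.trans (by gcongr)
  rw [hsplit]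
  exact (frobenius_norm_mul_le (frobenius_norm_mul_le hUe hTn') hVe).trans_eq (by ring)

/-- Elementary consequences of a leading singular value decomposition. -/
theorem IsLeadingSVD.basic {H : Matrix ι κ ℝ} {U : Matrix ι (Fin n) ℝ} {s : Fin n → ℝ}
    {V : Matrix κ (Fin n) ℝ} (h : IsLeadingSVD H U s V) :
    Uᵀ * U = 1 ∧ Vᵀ * V = 1 ∧ (∀ i, 0 ≤ s i) ∧ Uᵀ * H * V = diagonal s := by
  obtain ⟨a, b, Ue, Ve, t, hU, -, hV, -, -, -, hts, ht0, hH⟩ := h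
  obtain ⟨hU1, hU2, -, -⟩ := fromCols_isometry hU
  obtain ⟨hV1, -, hV3, -⟩ := fromCols_isometry hV
  refine ⟨hU1, hV1, fun i => (ht0 0).trans (hts i 0), ?_⟩
  rw [hH, fromCols_mul_fromBlocks, transpose_fromCols, fromCols_mul_fromRows]
  simp only [Matrix.mul_zero, add_zero, zero_add, Matrix.mul_add, Matrix.add_mul]
  rw [show Uᵀ * (U * diagonal s * Vᵀ) * V = (Uᵀ * U) * diagonal s * (Vᵀ * V) by
    simp only [Matrix.mul_assoc], ← Matrix.mul_assoc Uᵀ, ← Matrix.mul_assoc Uᵀ, hU2, hU1, hV1]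
  simp

end SVD

/-! Perturbation of the factors computed from singular value decompositions. -/

section Factors

variable {ι κ : Type} [Fintype ι] [Fintype κ] {n : ℕ}

theorem norm_isometry_mul_diagonal_sqrt_le {U : Matrix ι (Fin n) ℝ} (hU : Uᵀ * U = 1)
    {d : Fin n → ℝ} {r : ℝ} (hr : 1 ≤ r) (hd : ∀ i, d i ≤ r) :
    ‖U * diagonal fun i => Real.sqrt (d i)‖ ≤ n * n * r := by
  rw [frobenius_norm_isometry_mul hU]
  have h := frobenius_norm_le_of_forall_abs_le (diagonal fun i => Real.sqrt (d i))
    (r := r) (by linarith) ?_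
  · simpa using h
  · intro i j
    rcases eq_or_ne i j with rfl | hij
    · rw [diagonal_apply_eq, abs_of_nonneg (Real.sqrt_nonneg _)]
      apply Real.sqrt_le_iff.2 ⟨by linarith, ?_⟩
      nlinarith [hd i]
    · rw [diagonal_apply_ne _ hij, abs_zero]; linarith

theorem gram_mul_diagonal_sqrt {U : Matrix ι (Fin n) ℝ} (hU : Uᵀ * U = 1) {d e : Fin n → ℝ} :
    (U * diagonal fun i => Real.sqrt (d i))ᵀ * (U * diagonal fun i => Real.sqrt (e i)) =
      diagonal fun i => Real.sqrt (d i) * Real.sqrt (e i) := by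
  rw [transpose_mul, diagonal_transpose, Matrix.mul_assoc, ← Matrix.mul_assoc Uᵀ, hU,
    Matrix.one_mul, diagonal_mul_diagonal]

variable [DecidableEq ι] [DecidableEq κ]

theorem IsLeadingSVD.factors_mul {H : Matrix ι κ ℝ} {U : Matrix ι (Fin n) ℝ} {s : Fin n → ℝ}
    {V : Matrix κ (Fin n) ℝ} (h : IsLeadingSVD H U s V) :
    (U * diagonal fun i => Real.sqrt (s i)) * ((diagonal fun i => Real.sqrt (s i)) * Vᵀ) =
      U * diagonal s * Vᵀ := by
  obtain ⟨-, -, hs, -⟩ := h.basic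
  rw [Matrix.mul_assoc, ← Matrix.mul_assoc (diagonal _), diagonal_mul_diagonal, Matrix.mul_assoc]
  simp only [Real.mul_self_sqrt (hs _)]

theorem IsLeadingSVD.singular_value_le {H : Matrix ι κ ℝ} {U : Matrix ι (Fin n) ℝ}
    {s : Fin n → ℝ} {V : Matrix κ (Fin n) ℝ} (h : IsLeadingSVD H U s V) (i : Fin n) :
    s i ≤ n * ‖H‖ * n := by
  obtain ⟨hU, hV, -, hUHV⟩ := h.basic
  have h1 := frobenius_norm_le_card_of_isometry hU
  have h2 := frobenius_norm_le_card_of_isometry hV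
  simp only [Fintype.card_fin] at h1 h2
  have h3 := abs_apply_le_frobenius_norm (Uᵀ * H * V) i i
  rw [hUHV, diagonal_apply_eq, ← hUHV] at h3
  refine (le_abs_self _).trans (h3.trans ?_)
  exact frobenius_norm_mul_le (frobenius_norm_mul_le
    ((Matrix.frobenius_norm_transpose U).trans_le h1) le_rfl) h2

variable {O : Matrix ι (Fin n) ℝ} {R : Matrix (Fin n) κ ℝ} {L₀ : Matrix (Fin n) ι ℝ}
  {G₀ : Matrix κ (Fin n) ℝ}

theorem IsLeadingSVD.eq_of_factorization {U : Matrix ι (Fin n) ℝ} {s : Fin n → ℝ}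
    {V : Matrix κ (Fin n) ℝ} (h : IsLeadingSVD (O * R) U s V) : U * diagonal s * Vᵀ = O * R := by
  have h' : IsLeadingSVD (O * R + 0) U s V := by rwa [add_zero]
  have := h'.norm_sub_le
  rw [norm_zero, mul_zero, add_zero, norm_le_zero_iff, sub_eq_zero] at this
  exact this.symm

/-- `G₀ * L₀` is a generalized inverse of `O * R`. In singular coordinates it becomes a matrix `X`
with `diag(s) X diag(s) = diag(s)`, whose diagonal entries are the `(s i)⁻¹`. Positivity holds
because `L₀ * (O * R) * G₀ = 1` forces `det (diag s) ≠ 0`. -/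
theorem IsLeadingSVD.inv_singular_value_le (hL : L₀ * O = 1) (hG : R * G₀ = 1)
    {U : Matrix ι (Fin n) ℝ} {s : Fin n → ℝ} {V : Matrix κ (Fin n) ℝ}
    (h : IsLeadingSVD (O * R) U s V) (i : Fin n) :
    0 < s i ∧ (s i)⁻¹ ≤ n * ‖G₀ * L₀‖ * n := by
  obtain ⟨hU, hV, hs, -⟩ := h.basic
  have hH := h.eq_of_factorization
  have hpos : 0 < s i := by
    refine lt_of_le_of_ne (hs i) (Ne.symm ?_)
    have h1 : (L₀ * U) * diagonal s * (Vᵀ * G₀) = 1 := by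
      have : (L₀ * U) * diagonal s * (Vᵀ * G₀) = L₀ * (U * diagonal s * Vᵀ) * G₀ := by
        simp only [Matrix.mul_assoc]
      rw [this, hH, ← Matrix.mul_assoc, hL, Matrix.one_mul, hG]
    have h2 := congrArg Matrix.det h1
    rw [Matrix.det_mul, Matrix.det_mul, Matrix.det_diagonal, Matrix.det_one] at h2
    intro h0
    rw [Finset.prod_eq_zero (Finset.mem_univ i) h0] at h2
    simp at h2
  refine ⟨hpos, ?_⟩
  have h1 : diagonal s * (Vᵀ * (G₀ * L₀) * U) * diagonal s = diagonal s := by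
    have e1 : O * R * (G₀ * L₀) * (O * R) = O * R := by
      have : O * R * (G₀ * L₀) * (O * R) = O * (R * G₀) * (L₀ * O) * R := by
        simp only [Matrix.mul_assoc]
      rw [this, hG, hL, Matrix.mul_one, Matrix.mul_one]
    have e2 : diagonal s = Uᵀ * (U * diagonal s * Vᵀ) * V := by
      have : Uᵀ * (U * diagonal s * Vᵀ) * V = (Uᵀ * U) * diagonal s * (Vᵀ * V) := by
        simp only [Matrix.mul_assoc]
      rw [this, hU, hV, Matrix.one_mul, Matrix.mul_one]
    have e3 : Uᵀ * (U * diagonal s * Vᵀ * (G₀ * L₀) * (U * diagonal s * Vᵀ)) * V =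
        (Uᵀ * U) * (diagonal s * (Vᵀ * (G₀ * L₀) * U) * diagonal s) * (Vᵀ * V) := by
      simp only [Matrix.mul_assoc]
    rw [hU, hV, Matrix.one_mul, Matrix.mul_one, hH, e1, ← hH, ← e2] at e3
    exact e3.symm
  have h2 := congrFun (congrFun h1 i) i
  rw [Matrix.mul_diagonal, Matrix.diagonal_mul, diagonal_apply_eq] at h2
  have h3 : (s i)⁻¹ = (Vᵀ * (G₀ * L₀) * U) i i := by
    field_simp
    nlinarith
  rw [h3]
  have h4 := frobenius_norm_le_card_of_isometry hU
  have h5 := frobenius_norm_le_card_of_isometry hV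
  simp only [Fintype.card_fin] at h4 h5
  refine (le_abs_self _).trans ((abs_apply_le_frobenius_norm _ i i).trans ?_)
  exact frobenius_norm_mul_le (frobenius_norm_mul_le
    ((Matrix.frobenius_norm_transpose V).trans_le h5) le_rfl) h4

/-- Perturbation of the factors `U Σ^{1/2}` and `Σ^{1/2} Vᵀ` of a matrix of rank `n`. -/
theorem exists_svd_perturbation_bound (hL : L₀ * O = 1) (hG : R * G₀ = 1) :
    ∃ C : ℝ, 1 ≤ C ∧ ∀ (U : Matrix ι (Fin n) ℝ) (s : Fin n → ℝ) (V : Matrix κ (Fin n) ℝ),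
      IsLeadingSVD (O * R) U s V →
      (U * diagonal fun i => Real.sqrt (s i)) * ((diagonal fun i => Real.sqrt (s i)) * Vᵀ) =
        O * R ∧
      ‖U * diagonal fun i => Real.sqrt (s i)‖ ≤ C ∧
      ‖(diagonal fun i => Real.sqrt (s i)) * Vᵀ‖ ≤ C ∧
      ∀ (E : Matrix ι κ ℝ) (U' : Matrix ι (Fin n) ℝ) (s' : Fin n → ℝ) (V' : Matrix κ (Fin n) ℝ)
        (S : Matrix (Fin n) (Fin n) ℝ) (η : ℝ),
        IsLeadingSVD (O * R + E) U' s' V' → ‖E‖ ≤ η → C * η ≤ 1 →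
        S = (U * diagonal fun i => Real.sqrt (s i)⁻¹)ᵀ * (U' * diagonal fun i => Real.sqrt (s' i)) →
        IsUnit S.det ∧ ‖S‖ ≤ C ∧ ‖S⁻¹‖ ≤ C ∧
        ‖S * ((diagonal fun i => Real.sqrt (s' i)) * V'ᵀ) -
          (diagonal fun i => Real.sqrt (s i)) * Vᵀ‖ ≤ C * η ∧
        ‖(U' * diagonal fun i => Real.sqrt (s' i)) * S⁻¹ -
          U * diagonal fun i => Real.sqrt (s i)‖ ≤ C * η ∧
        ‖Sᵀ * S - 1‖ ≤ C * η := by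
  -- `r` dominates the singular values before and after perturbation (hence `‖O * R‖ + 1`) and the
  -- inverses of the unperturbed ones; `K` is the truncation constant; `M` bounds all balanced
  -- factors and their one-sided inverses.
  obtain ⟨r, hr⟩ : ∃ r : ℝ, r = n * (‖O * R‖ + 1) * n + n * ‖G₀ * L₀‖ * n + 1 := ⟨_, rfl⟩
  obtain ⟨K, hK⟩ : ∃ K : ℝ, K = (Fintype.card ι * Fintype.card κ : ℝ) ^ 2 := ⟨_, rfl⟩
  obtain ⟨M, hMr⟩ : ∃ M : ℝ, M = 1 + n * n * r := ⟨_, rfl⟩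
  have hr1 : 1 ≤ r := by
    rw [hr]
    have h1 : 0 ≤ n * (‖O * R‖ + 1) * n := by positivity
    have h2 : 0 ≤ n * ‖G₀ * L₀‖ * n := by positivity
    linarith
  have hK0 : 0 ≤ K := by rw [hK]; positivity
  have hM : 1 ≤ M := by
    rw [hMr]
    have : 0 ≤ n * n * r := by positivity
    linarith
  have hMM : M ≤ 16 * M ^ 26 := by
    have := pow_le_pow_right₀ hM (show 1 ≤ 26 by norm_num)
    rw [pow_one] at this
    linarith
  have hCK : 16 * M ^ 26 ≤ 16 * M ^ 26 * (K + 1) := by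
    have : 0 ≤ 16 * M ^ 26 * K := by positivity
    linarith
  refine ⟨16 * M ^ 26 * (K + 1), by linarith, ?_⟩
  intro U s V h
  obtain ⟨hU, hV, hs, -⟩ := h.basic
  have hprod := h.factors_mul.trans h.eq_of_factorization
  have hsr : ∀ i, s i ≤ r := by
    intro i
    have h1 := h.singular_value_le i
    have h2 : 0 ≤ n * ‖G₀ * L₀‖ * n := by positivity
    have h3 : (0 : ℝ) ≤ n * 1 * n := by positivity
    rw [hr]
    linarith
  have hsi : ∀ i, (s i)⁻¹ ≤ r := by
    intro i
    have h1 := (h.inv_singular_value_le hL hG i).2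
    have h2 : 0 ≤ n * (‖O * R‖ + 1) * n := by positivity
    rw [hr]
    linarith
  have hsqrt : ∀ i, Real.sqrt (s i)⁻¹ * Real.sqrt (s i) = 1 := by
    intro i
    have hp := (h.inv_singular_value_le hL hG i).1
    rw [← Real.sqrt_mul (by positivity), inv_mul_cancel₀ hp.ne', Real.sqrt_one]
  have hsqrt' : ∀ i, Real.sqrt (s i) * Real.sqrt (s i)⁻¹ = 1 := fun i => by rw [mul_comm, hsqrt]
  have hOM := norm_isometry_mul_diagonal_sqrt_le hU hr1 hsr
  have hVM := norm_isometry_mul_diagonal_sqrt_le hV hr1 hsr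
  have hLM := norm_isometry_mul_diagonal_sqrt_le hU hr1 hsi
  have hGM := norm_isometry_mul_diagonal_sqrt_le hV hr1 hsi
  have hRt : ∀ (W : Matrix κ (Fin n) ℝ) (d : Fin n → ℝ),
      (diagonal fun i => Real.sqrt (d i)) * Wᵀ =
        (W * diagonal fun i => Real.sqrt (d i))ᵀ := by
    intro W d
    rw [transpose_mul, diagonal_transpose]
  have hRM : ‖(diagonal fun i => Real.sqrt (s i)) * Vᵀ‖ ≤ M := by
    rw [hRt, Matrix.frobenius_norm_transpose]; linarith
  refine ⟨hprod, by linarith, by linarith, ?_⟩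
  intro E U' s' V' S η h' hE hη hS
  obtain ⟨hU', hV', hs', -⟩ := h'.basic
  have hη0 : 0 ≤ η := (norm_nonneg _).trans hE
  have hη1 : η ≤ 1 := by nlinarith
  have hsr' : ∀ i, s' i ≤ r := by
    intro i
    have h1 := h'.singular_value_le i
    have h2 : 0 ≤ n * ‖G₀ * L₀‖ * n := by positivity
    have h3 : ‖O * R + E‖ ≤ ‖O * R‖ + 1 := (norm_add_le _ _).trans (by linarith)
    have h4 : n * ‖O * R + E‖ * n ≤ n * (‖O * R‖ + 1) * n := by gcongr
    rw [hr]
    linarith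
  have hOM' := norm_isometry_mul_diagonal_sqrt_le hU' hr1 hsr'
  have hVM' := norm_isometry_mul_diagonal_sqrt_le hV' hr1 hsr'
  have hZ : ‖diagonal fun i => (s i)⁻¹‖ ≤ n * n * r := by
    have := frobenius_norm_le_of_forall_abs_le (diagonal fun i => (s i)⁻¹) (r := r)
      (by linarith) ?_
    · simpa using this
    · intro i j
      rcases eq_or_ne i j with rfl | hij
      · rw [diagonal_apply_eq, abs_of_nonneg (inv_nonneg.2 (hs i))]
        exact hsi i
      · rw [diagonal_apply_ne _ hij, abs_zero]; linarith
  -- Truncation contributes `K * η` and the perturbation itself `η`.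
  have hdist : ‖(U' * diagonal fun i => Real.sqrt (s' i)) *
        ((diagonal fun i => Real.sqrt (s' i)) * V'ᵀ) -
      (U * diagonal fun i => Real.sqrt (s i)) * ((diagonal fun i => Real.sqrt (s i)) * Vᵀ)‖ ≤
      (K + 1) * η := by
    rw [hprod, h'.factors_mul]
    have h1 := h'.norm_sub_le
    rw [← hK] at h1
    have e : U' * diagonal s' * V'ᵀ - O * R = E - (O * R + E - U' * diagonal s' * V'ᵀ) := by abel
    rw [e]
    refine (norm_sub_le _ _).trans ?_
    have : K * ‖E‖ ≤ K * η := by gcongr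
    linarith
  have hgram : ∀ {Q : Matrix ι (Fin n) ℝ} {W : Matrix κ (Fin n) ℝ} {d : Fin n → ℝ},
      Qᵀ * Q = 1 → Wᵀ * W = 1 →
      (Q * diagonal fun i => Real.sqrt (d i))ᵀ * (Q * diagonal fun i => Real.sqrt (d i)) =
      (diagonal fun i => Real.sqrt (d i)) * Wᵀ * ((diagonal fun i => Real.sqrt (d i)) * Wᵀ)ᵀ := by
    intro Q W d hQ hW
    rw [hRt, transpose_transpose, gram_mul_diagonal_sqrt hQ, gram_mul_diagonal_sqrt hW]
  have hmain := balanced_factor_perturbation (M := M) hM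
    (Oh := U * diagonal fun i => Real.sqrt (s i))
    (Ot := U' * diagonal fun i => Real.sqrt (s' i))
    (Rh := (diagonal fun i => Real.sqrt (s i)) * Vᵀ)
    (Rt := (diagonal fun i => Real.sqrt (s' i)) * V'ᵀ)
    (L := (U * diagonal fun i => Real.sqrt (s i)⁻¹)ᵀ)
    (G := V * diagonal fun i => Real.sqrt (s i)⁻¹)
    (Z := diagonal fun i => (s i)⁻¹) (η := (K + 1) * η)
    (by rw [gram_mul_diagonal_sqrt hU]; simp only [hsqrt, diagonal_one])
    (by rw [hRt, gram_mul_diagonal_sqrt hV]; simp only [hsqrt', diagonal_one])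
    (by
      rw [gram_mul_diagonal_sqrt hU, diagonal_mul_diagonal]
      rw [← diagonal_one]
      congr 1
      ext i
      rw [Real.mul_self_sqrt (hs i), mul_inv_cancel₀ (h.inv_singular_value_le hL hG i).1.ne'])
    (hgram hU hV) (hgram hU' hV')
    (by linarith) (by linarith) hRM
    (by rw [hRt, Matrix.frobenius_norm_transpose]; linarith)
    (by rw [Matrix.frobenius_norm_transpose]; linarith) (by linarith) (by linarith) hdist
    (by linarith)
  rw [← hS] at hmain
  obtain ⟨m1, m2, m3, m4, m5, m6⟩ := hmain
  refine ⟨m1, by linarith, by linarith, ?_, ?_, ?_⟩ <;> linarith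

end Factors

/-! Minimality of a quadruple. -/

namespace StateSpace

variable {n m p : ℕ}

theorem mcmillanDegree_le_of_impulse_eq {d : ℕ} {P : StateSpace n m p} (Q : StateSpace d m p)
    (h : ∀ t, Q.impulse t = P.impulse t) : P.mcmillanDegree ≤ d :=
  Nat.sInf_le ⟨Q, h⟩

/-- The dual quadruple. -/
def dual (P : StateSpace n m p) : StateSpace n p m := ⟨P.Aᵀ, P.Cᵀ, P.Bᵀ, P.Dᵀ⟩

theorem impulse_dual (P : StateSpace n m p) (t : ℕ) : P.dual.impulse t = (P.impulse t)ᵀ := by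
  cases t <;> simp [impulse, dual, transpose_mul, transpose_pow, Matrix.mul_assoc]

/-- Transposition exchanges controllability and observability, so only observability has to be
derived from minimality. -/
theorem mcmillanDegree_dual (P : StateSpace n m p) : P.dual.mcmillanDegree = P.mcmillanDegree := by
  unfold mcmillanDegree
  congr 1
  ext d
  constructor
  · rintro ⟨Q, hQ⟩
    exact ⟨Q.dual, fun t => by rw [impulse_dual, hQ, impulse_dual, transpose_transpose]⟩
  · rintro ⟨Q, hQ⟩
    exact ⟨Q.dual, fun t => by rw [impulse_dual, hQ, impulse_dual]⟩

/-- The states that produce zero output under zero input. -/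
def unobservable (P : StateSpace n m p) : Submodule ℝ (Fin n → ℝ) where
  carrier := {x | ∀ i : ℕ, P.C *ᵥ (P.A ^ i *ᵥ x) = 0}
  add_mem' := by
    intro x y hx hy i
    rw [Matrix.mulVec_add, Matrix.mulVec_add, hx, hy, add_zero]
  zero_mem' := by intro i; simp
  smul_mem' := by
    intro c x hx i
    rw [Matrix.mulVec_smul, Matrix.mulVec_smul, hx, smul_zero]

/-- The hypotheses say that `ι * π` may replace the identity after `C` and after `π * A`; hence `π`
intertwines the powers of the reduced matrix with those of `A`. -/
theorem impulse_reduced {d : ℕ} (P : StateSpace n m p) (π : Matrix (Fin d) (Fin n) ℝ)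
    (ι : Matrix (Fin n) (Fin d) ℝ) (hA : π * P.A * (ι * π) = π * P.A)
    (hC : P.C * (ι * π) = P.C) (t : ℕ) :
    (StateSpace.mk (π * P.A * ι) (π * P.B) (P.C * ι) P.D).impulse t = P.impulse t := by
  have key : ∀ t : ℕ, (π * P.A * ι) ^ t * π = π * P.A ^ t := by
    intro t
    induction t with
    | zero => simp
    | succ t ih =>
      rw [pow_succ, Matrix.mul_assoc, Matrix.mul_assoc (π * P.A), hA, ← Matrix.mul_assoc, ih,
        Matrix.mul_assoc, ← pow_succ]
  cases t with
  | zero => rfl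
  | succ t =>
    simp only [impulse]
    rw [Matrix.mul_assoc, ← Matrix.mul_assoc _ π, key, ← Matrix.mul_assoc, ← Matrix.mul_assoc,
      Matrix.mul_assoc P.C, hC]

/-- Otherwise the quotient by the unobservable subspace, which is `A`-invariant and killed by `C`,
carries a realization with fewer states. -/
theorem unobservable_eq_bot (P : StateSpace n m p) (h : P.mcmillanDegree = n) :
    P.unobservable = ⊥ := by
  by_contra hne
  set W := P.unobservable with hW
  set d := Module.finrank ℝ ((Fin n → ℝ) ⧸ W) with hd
  have hdn : d < n := by
    have h1 := Submodule.finrank_quotient_add_finrank W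
    have h2 : 0 < Module.finrank ℝ W := by
      rw [Nat.pos_iff_ne_zero]
      intro h0
      exact hne (Submodule.finrank_eq_zero.1 h0)
    simp only [Module.finrank_fin_fun] at h1
    omega
  let e : ((Fin n → ℝ) ⧸ W) ≃ₗ[ℝ] (Fin d → ℝ) := (Module.finBasis ℝ _).equivFun
  let f : (Fin n → ℝ) →ₗ[ℝ] (Fin d → ℝ) := e.toLinearMap ∘ₗ W.mkQ
  have hf : LinearMap.range f = ⊤ := by
    rw [LinearMap.range_eq_top]
    exact e.surjective.comp W.mkQ_surjective
  obtain ⟨g, hg⟩ := f.exists_rightInverse_of_surjective hf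
  have hker : ∀ x, f x = 0 ↔ x ∈ W := by
    intro x
    simp [f]
  have hmem : ∀ x, g (f x) - x ∈ W := by
    intro x
    rw [← hker, map_sub, sub_eq_zero]
    exact LinearMap.congr_fun hg (f x)
  set π := LinearMap.toMatrix' f
  set ι := LinearMap.toMatrix' g
  have hπ : ∀ x, π *ᵥ x = f x := fun x => LinearMap.toMatrix'_mulVec f x
  have hι : ∀ x, ι *ᵥ x = g x := fun x => LinearMap.toMatrix'_mulVec g x
  have hAW : ∀ x ∈ W, P.A *ᵥ x ∈ W := by
    intro x hx i
    have := hx (i + 1)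
    rwa [pow_succ, ← Matrix.mulVec_mulVec] at this
  have hle := mcmillanDegree_le_of_impulse_eq _ (P.impulse_reduced π ι ?_ ?_)
  · omega
  · apply Matrix.ext_of_mulVec_single
    intro i
    simp only [← Matrix.mulVec_mulVec, hπ, hι]
    rw [← sub_eq_zero, ← map_sub, ← Matrix.mulVec_sub, hker]
    exact hAW _ (hmem _)
  · apply Matrix.ext_of_mulVec_single
    intro i
    simp only [← Matrix.mulVec_mulVec, hπ, hι]
    rw [← sub_eq_zero, ← Matrix.mulVec_sub]
    have := hmem (Pi.single i 1) 0
    simpa using this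

/-- By Cayley–Hamilton every power of `A` is a combination of the powers below `n`. -/
theorem mem_unobservable_of_lt (P : StateSpace n m p) {x : Fin n → ℝ}
    (hx : ∀ i < n, P.C *ᵥ (P.A ^ i *ᵥ x) = 0) : x ∈ P.unobservable := by
  intro i
  rcases Nat.eq_zero_or_pos n with rfl | hn
  · have : x = 0 := Subsingleton.elim _ _
    simp [this]
  have : Nonempty (Fin n) := ⟨⟨0, hn⟩⟩
  have hdeg : (Polynomial.X ^ i %ₘ P.A.charpoly).natDegree < n := by
    have h1 := Polynomial.natDegree_modByMonic_lt (Polynomial.X ^ i) (Matrix.charpoly_monic P.A)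
      (by
        intro h
        have := Matrix.charpoly_natDegree_eq_dim P.A
        rw [h] at this
        simp at this
        omega)
    rwa [Matrix.charpoly_natDegree_eq_dim, Fintype.card_fin] at h1
  rw [Matrix.pow_eq_aeval_mod_charpoly, Polynomial.aeval_eq_sum_range' hdeg, Matrix.sum_mulVec,
    Matrix.mulVec_sum]
  apply Finset.sum_eq_zero
  intro j hj
  rw [Matrix.smul_mulVec, Matrix.mulVec_smul, hx j (Finset.mem_range.1 hj), smul_zero]

theorem eq_zero_of_unobservable (P : StateSpace n m p) (h : P.mcmillanDegree = n)
    {x : Fin n → ℝ} (hx : ∀ i < n, P.C *ᵥ (P.A ^ i *ᵥ x) = 0) : x = 0 := by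
  have := P.mem_unobservable_of_lt hx
  rwa [P.unobservable_eq_bot h, Submodule.mem_bot] at this

/-- If `t` steps of observation and the state after `t` steps vanish, so does the state. -/
theorem eq_zero_of_pow_mulVec_eq_zero (P : StateSpace n m p) (h : P.mcmillanDegree = n)
    {x : Fin n → ℝ} {t : ℕ} (hx : ∀ i < t, P.C *ᵥ (P.A ^ i *ᵥ x) = 0) (ht : P.A ^ t *ᵥ x = 0) :
    x = 0 := by
  apply P.eq_zero_of_unobservable h
  intro i _
  rcases lt_or_ge i t with hi | hi
  · exact hx i hi
  · obtain ⟨j, rfl⟩ := Nat.exists_eq_add_of_le' hi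
    rw [pow_add, ← Matrix.mulVec_mulVec, ht]
    simp

end StateSpace

/-! Windows of a switching sequence. -/

section Switching

variable {σ : ℕ} {N : ℕ} {φ : ℕ → Fin σ} {d : ℕ}

/-- The next switch after `k` is consecutive to it and no later than `l`. -/
theorem MinDwellAtLeast.add_le (h : MinDwellAtLeast N φ d) {k l : ℕ} (hk : IsSwitch N φ k)
    (hl : IsSwitch N φ l) (hkl : k < l) : k + d ≤ l := by
  classical
  have hex : ∃ j, k < j ∧ IsSwitch N φ j := ⟨l, hkl, hl⟩
  have hspec := Nat.find_spec hex
  have := h k (Nat.find hex) hk hspec.2 hspec.1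
    (fun j hj hj' hs => Nat.find_min hex hj' ⟨hj, hs⟩)
  exact this.trans (Nat.find_min' hex ⟨hkl, hl⟩)

theorem eq_of_no_switch {a b : ℕ} (ha : 1 ≤ a) (hb : b ≤ N)
    (h : ∀ s, a < s → s ≤ b → ¬ IsSwitch N φ s) {j : ℕ} (haj : a ≤ j) (hjb : j ≤ b) :
    φ j = φ a := by
  induction j, haj using Nat.le_induction with
  | base => rfl
  | succ j haj ih =>
    rw [← ih (by omega)]
    by_contra hne
    exact h (j + 1) (by omega) hjb ⟨by omega, by omega, by simpa using hne⟩

/-- A window of `d` times is constant, or is constant up to a switch that starts a constant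
segment of `d` times. -/
theorem MinDwellAtLeast.forward (h : MinDwellAtLeast N φ d) {k : ℕ} (hk : 1 ≤ k)
    (hN : k + 2 * d ≤ N + 1) :
    ∃ t, t ≤ d ∧ (∀ i < t, φ (k + i) = φ k) ∧ (t < d → ∀ i < d, φ (k + t + i) = φ (k + t)) := by
  by_cases hs : ∃ s, k < s ∧ s < k + d ∧ IsSwitch N φ s
  · obtain ⟨s, hks, hsd, hsw⟩ := hs
    refine ⟨s - k, by omega, ?_, ?_⟩
    · intro i hi
      refine eq_of_no_switch (N := N) (b := s - 1) hk (by omega) ?_ (by omega) (by omega)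
      intro l hl hl' hlw
      have := h.add_le hlw hsw (by omega)
      omega
    · intro _ i hi
      rw [show k + (s - k) = s by omega]
      refine eq_of_no_switch (N := N) (b := s + d - 1) (by omega) (by omega) ?_ (by omega)
        (by omega)
      intro l hl hl' hlw
      have := h.add_le hsw hlw (by omega)
      omega
  · refine ⟨d, le_rfl, ?_, fun h => absurd h (lt_irrefl _)⟩
    intro i hi
    refine eq_of_no_switch (N := N) (b := k + d - 1) hk (by omega) ?_ (by omega) (by omega)
    intro l hl hl' hlw
    exact hs ⟨l, hl, by omega, hlw⟩

/-- The window of `d` times before `k` is constant, or is constant back to a switch preceded by a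
constant segment of `d` times. -/
theorem MinDwellAtLeast.backward (h : MinDwellAtLeast N φ d) {k : ℕ} (hk : 2 * d + 1 ≤ k)
    (hN : k ≤ N + 1) :
    ∃ t, t ≤ d ∧ (∀ i < t, φ (k - 1 - i) = φ (k - 1)) ∧
      (t < d → ∀ i < d, φ (k - 1 - t - i) = φ (k - 1 - t)) := by
  by_cases hs : ∃ s, k < s + d ∧ s < k ∧ IsSwitch N φ s
  · obtain ⟨s, hks, hsd, hsw⟩ := hs
    refine ⟨k - s, by omega, ?_, ?_⟩
    · have hc : ∀ j, s ≤ j → j ≤ k - 1 → φ j = φ s := by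
        intro j hj hj'
        refine eq_of_no_switch (N := N) (b := k - 1) (by omega) (by omega) ?_ hj hj'
        intro l hl hl' hlw
        have := h.add_le hsw hlw (by omega)
        omega
      intro i hi
      rw [hc _ (by omega) (by omega), hc (k - 1) (by omega) (by omega)]
    -- Here `2 * d + 1 ≤ k < s + d` gives `s - d > 1`, so the earlier segment lies within the time
    -- range even if `s` is the first switch.
    · have hc : ∀ j, s - d ≤ j → j ≤ s - 1 → φ j = φ (s - d) := by
        intro j hj hj'
        refine eq_of_no_switch (N := N) (b := s - 1) (by omega) (by omega) ?_ hj hj'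
        intro l hl hl' hlw
        have := h.add_le hlw hsw (by omega)
        omega
      intro _ i hi
      rw [hc _ (by omega) (by omega), hc (k - 1 - (k - s)) (by omega) (by omega)]
  · refine ⟨d, le_rfl, ?_, fun h => absurd h (lt_irrefl _)⟩
    have hc : ∀ j, k - d ≤ j → j ≤ k - 1 → φ j = φ (k - d) := by
      intro j hj hj'
      refine eq_of_no_switch (N := N) (b := k - 1) (by omega) (by omega) ?_ hj hj'
      intro l hl hl' hlw
      exact hs ⟨l, by omega, by omega, hlw⟩
    intro i hi
    rw [hc _ (by omega) (by omega), hc (k - 1) (by omega) (by omega)]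

end Switching

/-! Observability and controllability of the switched system. -/

theorem exists_left_inverse_of_mulVec {ι : Type*} [Fintype ι] {n : ℕ} {X : Matrix ι (Fin n) ℝ}
    (h : ∀ x, X *ᵥ x = 0 → x = 0) : ∃ L : Matrix (Fin n) ι ℝ, L * X = 1 := by
  classical
  obtain ⟨g, hg⟩ := X.mulVecLin.exists_leftInverse_of_injective
    (LinearMap.ker_eq_bot'.2 fun x hx => h x hx)
  refine ⟨LinearMap.toMatrix' g, ?_⟩
  apply Matrix.ext_of_mulVec_single
  intro i
  rw [← Matrix.mulVec_mulVec, LinearMap.toMatrix'_mulVec, Matrix.one_mulVec]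
  exact LinearMap.congr_fun hg _

section Transition

variable {n m p σ : ℕ}

theorem transitionAux_add (P : ℕ → StateSpace n m p) (l s t : ℕ) :
    transitionAux P l (s + t) = transitionAux P (l + s) t * transitionAux P l s := by
  induction t with
  | zero => simp [transitionAux]
  | succ t ih => rw [← add_assoc, transitionAux, ih, transitionAux, Matrix.mul_assoc, add_assoc]

theorem transitionAux_switchedSystem_of_eq (modes : Fin σ → StateSpace n m p) (φ : ℕ → Fin σ)
    {a t : ℕ} {c : Fin σ} (h : ∀ i < t, φ (a + i) = c) :
    transitionAux (switchedSystem modes φ) a t = (modes c).A ^ t := by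
  induction t with
  | zero => simp [transitionAux]
  | succ t ih =>
    rw [transitionAux, ih fun i hi => h i (by omega), pow_succ', switchedSystem,
      h t (by omega)]

/-- Observability matrix over the times `k, …, k+q-1`. -/
noncomputable def obsMatrix (P : ℕ → StateSpace n m p) (k q : ℕ) :
    Matrix (Fin q × Fin p) (Fin n) ℝ :=
  Matrix.of fun i j => ((P (k + i.1)).C * transitionAux P k i.1) i.2 j

/-- Controllability matrix over the times `k-r, …, k-1`. -/
noncomputable def ctrlMatrix (P : ℕ → StateSpace n m p) (k r : ℕ) :
    Matrix (Fin n) (Fin r × Fin m) ℝ :=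
  Matrix.of fun i j => (transitionAux P (k - j.1) j.1 * (P (k - 1 - j.1)).B) i j.2

/-- The transition from past to future splits at the state at time `k`. The condition `r < k` keeps
all subtractions of times genuine. -/
theorem hankel_markov (P : ℕ → StateSpace n m p) {k q r : ℕ} (hk : r < k) :
    hankel q r (markov P) k = obsMatrix P k q * ctrlMatrix P k r := by
  ext i j
  have hj := j.1.2
  have h1 : k - 1 - (j.1 : ℕ) < k + i.1 := by omega
  have h2 : k - 1 - (j.1 : ℕ) + 1 = k - j.1 := by omega
  have h3 : k + (i.1 : ℕ) - (k - j.1) = j.1 + i.1 := by omega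
  have h4 : k - (j.1 : ℕ) + j.1 = k := by omega
  simp only [hankel, Matrix.of_apply, markov, if_pos h1, transition, h2, h3, transitionAux_add, h4]
  rw [← Matrix.mul_assoc, Matrix.mul_assoc, Matrix.mul_apply, Matrix.mul_apply]
  rfl

theorem shiftDown_mul_obsMatrix (P : ℕ → StateSpace n m p) (k q : ℕ) :
    shiftDown q p * obsMatrix P k (q + 1) = obsMatrix P k q := by
  ext i j
  rw [Matrix.mul_apply, Finset.sum_eq_single (i.1.castSucc, i.2)]
  · simp [shiftDown, obsMatrix]
  · rintro ⟨a, b⟩ - hne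
    have : ¬ (a = i.1.castSucc ∧ b = i.2) := fun h => hne (Prod.ext h.1 h.2)
    simp [shiftDown, this]
  · simp

variable {N : ℕ} {modes : Fin σ → StateSpace n m p} {φ : ℕ → Fin σ}

/-- If the first `n` times are constant, one observable mode suffices. Otherwise a switch occurs
after `t < n` steps, and the next `n` outputs show that the state there, `A ^ t x`, vanishes; with
the first `t` outputs this forces `x = 0`. No invertibility of `A` is needed. -/
theorem exists_left_inverse_obsMatrix (hdegree : ∀ j, (modes j).mcmillanDegree = n)
    (hdwell : MinDwellAtLeast N φ n) {k : ℕ} (hk : 1 ≤ k) (hN : k + 2 * n ≤ N + 1) :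
    ∃ L : Matrix (Fin n) (Fin (2 * n) × Fin p) ℝ,
      L * obsMatrix (switchedSystem modes φ) k (2 * n) = 1 := by
  apply exists_left_inverse_of_mulVec
  intro x hx
  have hx' : ∀ i < 2 * n, (modes (φ (k + i))).C *ᵥ
      (transitionAux (switchedSystem modes φ) k i *ᵥ x) = 0 := by
    intro i hi
    ext a
    rw [Matrix.mulVec_mulVec]
    exact congrFun hx (⟨i, hi⟩, a)
  obtain ⟨t, htn, hc, hc'⟩ := hdwell.forward hk hN
  have hpow : ∀ i ≤ t, transitionAux (switchedSystem modes φ) k i = (modes (φ k)).A ^ i :=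
    fun i hi => transitionAux_switchedSystem_of_eq modes φ fun l hl => hc l (by omega)
  have hobs : ∀ i < t, (modes (φ k)).C *ᵥ ((modes (φ k)).A ^ i *ᵥ x) = 0 := by
    intro i hi
    have := hx' i (by omega)
    rwa [hpow i hi.le, hc i hi] at this
  rcases htn.eq_or_lt with rfl | htn
  · exact (modes (φ k)).eq_zero_of_unobservable (hdegree _) hobs
  · refine (modes (φ k)).eq_zero_of_pow_mulVec_eq_zero (hdegree _) hobs ?_
    apply (modes (φ (k + t))).eq_zero_of_unobservable (hdegree _)
    intro i hi
    have := hx' (t + i) (by omega)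
    rwa [transitionAux_add, hpow t le_rfl, ← add_assoc, hc' htn i hi, ← Matrix.mulVec_mulVec,
      transitionAux_switchedSystem_of_eq modes φ fun l hl => hc' htn l (by omega)] at this

/-- The observability argument for the dual modes, run backwards in time. -/
theorem exists_right_inverse_ctrlMatrix (hdegree : ∀ j, (modes j).mcmillanDegree = n)
    (hdwell : MinDwellAtLeast N φ n) {k : ℕ} (hk : 2 * n + 1 ≤ k) (hN : k ≤ N + 1) :
    ∃ G : Matrix (Fin (2 * n) × Fin m) (Fin n) ℝ,
      ctrlMatrix (switchedSystem modes φ) k (2 * n) * G = 1 := by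
  suffices h : ∃ L : Matrix (Fin n) (Fin (2 * n) × Fin m) ℝ,
      L * (ctrlMatrix (switchedSystem modes φ) k (2 * n))ᵀ = 1 by
    obtain ⟨L, hL⟩ := h
    refine ⟨Lᵀ, ?_⟩
    rw [← transpose_transpose (ctrlMatrix _ _ _), ← transpose_mul, hL, transpose_one]
  apply exists_left_inverse_of_mulVec
  intro x hx
  have hx' : ∀ i < 2 * n, (modes (φ (k - 1 - i))).Bᵀ *ᵥ
      ((transitionAux (switchedSystem modes φ) (k - i) i)ᵀ *ᵥ x) = 0 := by
    intro i hi
    ext a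
    rw [Matrix.mulVec_mulVec, ← transpose_mul]
    exact congrFun hx (⟨i, hi⟩, a)
  have hdual : ∀ j, (modes j).dual.mcmillanDegree = n := fun j => by
    rw [StateSpace.mcmillanDegree_dual, hdegree]
  obtain ⟨t, htn, hc, hc'⟩ := hdwell.backward hk hN
  have hpow : ∀ i ≤ t, transitionAux (switchedSystem modes φ) (k - i) i =
      (modes (φ (k - 1))).A ^ i := by
    intro i hi
    refine transitionAux_switchedSystem_of_eq modes φ fun l hl => ?_
    rw [show k - i + l = k - 1 - (i - 1 - l) by omega]
    exact hc _ (by omega)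
  have hobs : ∀ i < t, (modes (φ (k - 1))).dual.C *ᵥ ((modes (φ (k - 1))).dual.A ^ i *ᵥ x) = 0 := by
    intro i hi
    have := hx' i (by omega)
    rwa [hpow i hi.le, hc i hi, transpose_pow] at this
  rcases htn.eq_or_lt with rfl | htn
  · exact (modes (φ (k - 1))).dual.eq_zero_of_unobservable (hdual _) hobs
  · refine (modes (φ (k - 1))).dual.eq_zero_of_pow_mulVec_eq_zero (hdual _) hobs ?_
    apply (modes (φ (k - 1 - t))).dual.eq_zero_of_unobservable (hdual _)
    intro i hi
    have := hx' (t + i) (by omega)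
    have hpow' : transitionAux (switchedSystem modes φ) (k - t - i) i =
        (modes (φ (k - 1 - t))).A ^ i := by
      refine transitionAux_switchedSystem_of_eq modes φ fun l hl => ?_
      rw [show k - t - i + l = k - 1 - t - (i - 1 - l) by omega]
      exact hc' htn _ (by omega)
    rw [add_comm t i, transitionAux_add, show k - (i + t) = k - t - i by omega, hpow',
      show k - t - i + i = k - t by omega, hpow t le_rfl,
      show k - 1 - (i + t) = k - 1 - t - i by omega, hc' htn i hi, transpose_mul,
      ← Matrix.mulVec_mulVec, transpose_pow, transpose_pow] at this
    exact this

end Transition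

/-! ### Uniform constants over all times, and assembly of the theorem. -/

/-- Bounds, valid for all large `C`, on the factors of a matrix `O * R` of rank `n` such that even
`J * O` has full column rank, and on their perturbation. -/
theorem eventually_svd_perturbation_bound {ι κ l : Type} [Fintype ι] [Fintype κ] [Fintype l]
    [DecidableEq ι] [DecidableEq κ] {n : ℕ} {O : Matrix ι (Fin n) ℝ} {R : Matrix (Fin n) κ ℝ}
    {J : Matrix l ι ℝ} {L₀ : Matrix (Fin n) l ℝ} {G₀ : Matrix κ (Fin n) ℝ}
    (hL : L₀ * (J * O) = 1) (hG : R * G₀ = 1) :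
    ∀ᶠ C : ℝ in atTop, ∀ (U : Matrix ι (Fin n) ℝ) (s : Fin n → ℝ) (V : Matrix κ (Fin n) ℝ),
      IsLeadingSVD (O * R) U s V →
      ‖U * diagonal fun i => Real.sqrt (s i)‖ ≤ C ∧
      (∃ L' : Matrix (Fin n) l ℝ,
        L' * (J * (U * diagonal fun i => Real.sqrt (s i))) = 1 ∧ ‖L'‖ ≤ C) ∧
      ∀ (E : Matrix ι κ ℝ) (U' : Matrix ι (Fin n) ℝ) (s' : Fin n → ℝ) (V' : Matrix κ (Fin n) ℝ)
        (S : Matrix (Fin n) (Fin n) ℝ) (η : ℝ),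
        IsLeadingSVD (O * R + E) U' s' V' → ‖E‖ ≤ η → C * η ≤ 1 →
        S = (U * diagonal fun i => Real.sqrt (s i)⁻¹)ᵀ * (U' * diagonal fun i => Real.sqrt (s' i)) →
        IsUnit S.det ∧ ‖S‖ ≤ C ∧ ‖S⁻¹‖ ≤ C ∧
        ‖S * ((diagonal fun i => Real.sqrt (s' i)) * V'ᵀ) -
          (diagonal fun i => Real.sqrt (s i)) * Vᵀ‖ ≤ C * η ∧
        ‖(U' * diagonal fun i => Real.sqrt (s' i)) * S⁻¹ -
          U * diagonal fun i => Real.sqrt (s i)‖ ≤ C * η ∧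
        ‖Sᵀ * S - 1‖ ≤ C * η := by
  obtain ⟨C₀, hC₀, h⟩ := exists_svd_perturbation_bound (L₀ := L₀ * J) (O := O) (R := R) (G₀ := G₀)
    (by rw [Matrix.mul_assoc, hL]) hG
  filter_upwards [eventually_ge_atTop C₀, eventually_ge_atTop (C₀ * ‖G₀‖ * ‖L₀‖)] with C hC hC'
  intro U s V hsvd
  obtain ⟨hprod, hOn, hRn, hpert⟩ := h U s V hsvd
  refine ⟨hOn.trans hC, ⟨(diagonal fun i => Real.sqrt (s i)) * Vᵀ * G₀ * L₀, ?_, ?_⟩, ?_⟩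
  · rw [Matrix.mul_assoc]
    -- For square matrices the order may be reversed, and then the balanced factors meet and can be
    -- replaced by `O * R`.
    apply mul_eq_one_comm.1
    have : L₀ * (J * (U * diagonal fun i => Real.sqrt (s i))) *
        ((diagonal fun i => Real.sqrt (s i)) * Vᵀ * G₀) =
        L₀ * (J * ((U * diagonal fun i => Real.sqrt (s i)) *
          ((diagonal fun i => Real.sqrt (s i)) * Vᵀ) * G₀)) := by
      simp only [Matrix.mul_assoc]
    rw [this, hprod, Matrix.mul_assoc, hG, Matrix.mul_one, hL]
  · exact (frobenius_norm_mul_le (frobenius_norm_mul_le hRn le_rfl) le_rfl).trans hC'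
  · intro E U' s' V' S η hsvd' hE hη hS
    have hη0 : 0 ≤ η := (norm_nonneg _).trans hE
    have hle : C₀ * η ≤ C * η := by gcongr
    obtain ⟨h1, h2, h3, h4, h5, h6⟩ := hpert E U' s' V' S η hsvd' hE (hle.trans hη) hS
    exact ⟨h1, h2.trans hC, h3.trans hC, h4.trans hle, h5.trans hle, h6.trans hle⟩

/-- Perturbation of `(J₁ X₁)† J₂ X₂`. -/
theorem norm_leftInv_mul_sub_le (n : ℕ) {ι l : Type} [Fintype ι] [Fintype l] {C : ℝ} (hC : 1 ≤ C)
    (J₁ J₂ : Matrix l ι ℝ) : ∃ K : ℝ, 1 ≤ K ∧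
    ∀ {X₁ Y₁ X₂ Y₂ : Matrix ι (Fin n) ℝ} {L : Matrix (Fin n) l ℝ} {η : ℝ},
      L * (J₁ * X₁) = 1 → ‖L‖ ≤ C → ‖X₁‖ ≤ C → ‖X₂‖ ≤ C → ‖Y₁ - X₁‖ ≤ C * η →
      ‖Y₂ - X₂‖ ≤ C * η → K * η ≤ 1 →
      ‖leftInv (J₁ * Y₁) * (J₂ * Y₂) - leftInv (J₁ * X₁) * (J₂ * X₂)‖ ≤ K * η := by
  set a := ‖J₁‖
  set b := ‖J₂‖
  have ha : 0 ≤ a := norm_nonneg _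
  have hb : 0 ≤ b := norm_nonneg _
  obtain ⟨C₁, hC₁, h⟩ := leftInv_lipschitz n (M := C * (1 + a)) (by nlinarith)
  have t0 : 0 ≤ C := by linarith
  have t1 : 0 ≤ C₁ * (a * C) := by positivity
  have t2 : 0 ≤ C₁ * (a * C) * (b * (2 * C)) := by positivity
  have t3 : 0 ≤ C₁ * (b * C) := by positivity
  refine ⟨1 + C₁ * (a * C) + C₁ * (a * C) * (b * (2 * C)) + C₁ * (b * C), by linarith, ?_⟩
  intro X₁ Y₁ X₂ Y₂ L η hL hLC hX₁ hX₂ hY₁ hY₂ hη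
  have hCη : 0 ≤ C * η := (norm_nonneg _).trans hY₁
  have hη0 : 0 ≤ η := nonneg_of_mul_nonneg_right hCη (by linarith)
  have u1 := mul_nonneg t1 hη0
  have u2 := mul_nonneg t2 hη0
  have u3 := mul_nonneg t3 hη0
  have hη1 : η ≤ 1 := by linarith
  have hd : ‖J₁ * Y₁ - J₁ * X₁‖ ≤ a * (C * η) := by
    rw [← Matrix.mul_sub]
    exact frobenius_norm_mul_le le_rfl hY₁
  have hX : ‖J₁ * X₁‖ ≤ C * (1 + a) :=
    (frobenius_norm_mul_le le_rfl hX₁).trans (by linarith)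
  obtain ⟨hi, hdi⟩ := h hL (hLC.trans (by nlinarith)) hX hd (by linarith)
  have hY₂n : ‖Y₂‖ ≤ 2 * C := by
    have h1 := norm_add_le (Y₂ - X₂) X₂
    rw [sub_add_cancel] at h1
    have : C * η ≤ C := mul_le_of_le_one_right t0 hη1
    linarith
  have e : leftInv (J₁ * Y₁) * (J₂ * Y₂) - leftInv (J₁ * X₁) * (J₂ * X₂) =
      (leftInv (J₁ * Y₁) - leftInv (J₁ * X₁)) * (J₂ * Y₂) +
        leftInv (J₁ * X₁) * (J₂ * (Y₂ - X₂)) := by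
    simp only [Matrix.sub_mul, Matrix.mul_sub]
    abel
  rw [e]
  refine (norm_add_le _ _).trans ?_
  have v1 := frobenius_norm_mul_le hdi (frobenius_norm_mul_le (le_refl b) hY₂n)
  have v2 := frobenius_norm_mul_le hi (frobenius_norm_mul_le (le_refl b) hY₂)
  linarith

theorem NoiseBounded.norm_hankel_le {n m p N : ℕ} {ε : ℝ}
    {e : ℕ → ℕ → Matrix (Fin p) (Fin m) ℝ} (h : NoiseBounded n N ε e) (hε : 0 ≤ ε) {k : ℕ}
    (hk : 2 * n + 1 ≤ k) (hN : k + 4 * n ≤ N + 1) :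
    ‖hankel (2 * n + 1) (2 * n) e k‖ ≤
      Fintype.card (Fin (2 * n + 1) × Fin p) * Fintype.card (Fin (2 * n) × Fin m) * ε := by
  apply frobenius_norm_le_of_forall_abs_le _ hε
  rintro ⟨i, a⟩ ⟨j, b⟩
  have hi := i.2
  have hj := j.2
  exact (abs_apply_le_frobenius_norm _ a b).trans
    (h _ _ (by omega) (by omega) (by omega) (by omega))

theorem hankel_add {m p : ℕ} (q r : ℕ) (h e : ℕ → ℕ → Matrix (Fin p) (Fin m) ℝ) (k : ℕ) :
    hankel q r (fun k l => h k l + e k l) k = hankel q r h k + hankel q r e k := by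
  ext i j
  simp [hankel]

theorem mainTheorem2 {n m p σ : ℕ} (N : ℕ) (modes : Fin σ → StateSpace n m p)
    (φ : ℕ → Fin σ)
    (hstable : ∀ j, (modes j).IsBIBOStable)
    (hdegree : ∀ j, (modes j).mcmillanDegree = n)
    (hdwell : MinDwellAtLeast N φ n) :
    ∃ c : ℝ, 0 < c ∧ ∃ εs : ℝ, 0 < εs ∧ ∃ ω : ℝ → ℝ, Tendsto ω (𝓝[>] 0) (𝓝 0) ∧
      ∀ Phat : ℕ → StateSpace n m p,
        IsAlgorithmOutput N (markov (switchedSystem modes φ)) Phat →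
      ∀ ε : ℝ, 0 < ε → ε ≤ εs →
      ∀ e : ℕ → ℕ → Matrix (Fin p) (Fin m) ℝ, NoiseBounded n N ε e →
      ∀ Ptilde : ℕ → StateSpace n m p,
        IsAlgorithmOutput N (fun k l => markov (switchedSystem modes φ) k l + e k l) Ptilde →
      ∃ (Peps : ℕ → StateSpace n m p) (S : ℕ → Matrix (Fin n) (Fin n) ℝ),
        IsLyapunovTransformOn (estimationTimes n N) S Ptilde Peps ∧
        (∀ k ∈ estimationTimes n N,
          ‖(Peps k).A - (Phat k).A‖ ≤ c * ε ∧
          ‖(Peps k).B - (Phat k).B‖ ≤ c * ε ∧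
          ‖(Peps k).C - (Phat k).C‖ ≤ c * ε ∧
          ‖(Peps k).D - (Phat k).D‖ ≤ c * ε) ∧
        (∀ k ∈ estimationTimes n N, ∀ j ∈ ({k, k + 1} : Set ℕ),
          ‖(S j)ᵀ * S j - 1‖ ≤ ω ε) := by
  set P := switchedSystem modes φ with hP
  -- The bound is `N + 1` because the estimate at `k` also uses the decomposition at `k + 1`.
  -- Finiteness lets a single constant `C` serve all times.
  have hfin : {j | 2 * n + 1 ≤ j ∧ j + 4 * n ≤ N + 1}.Finite :=
    (Set.finite_Iic (N + 1)).subset fun j hj => by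
      have := hj.2
      simp only [Set.mem_Iic]
      omega
  have hev := (Filter.eventually_all_finite hfin).2 (fun j hj => by
    obtain ⟨L₀, hL₀⟩ := exists_left_inverse_obsMatrix (k := j) hdegree hdwell
      (by have := hj.1; omega) (by have := hj.2; omega)
    obtain ⟨G₀, hG₀⟩ := exists_right_inverse_ctrlMatrix (k := j) hdegree hdwell
      hj.1 (by have := hj.2; omega)
    exact eventually_svd_perturbation_bound (O := obsMatrix P j (2 * n + 1))
      (R := ctrlMatrix P j (2 * n)) (J := shiftDown (2 * n) p) (L₀ := L₀) (G₀ := G₀)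
      (by rw [shiftDown_mul_obsMatrix, hL₀]) hG₀)
  obtain ⟨C, hbound, hC⟩ := (hev.and (eventually_ge_atTop 1)).exists
  obtain ⟨K, hK, hA⟩ := norm_leftInv_mul_sub_le n hC (shiftDown (2 * n) p) (shiftUp (2 * n) p)
  obtain ⟨ν, hν, hν1⟩ : ∃ ν : ℝ, (Fintype.card (Fin (2 * n + 1) × Fin p) *
      Fintype.card (Fin (2 * n) × Fin m) : ℝ) ≤ ν ∧ 1 ≤ ν := ⟨_, le_max_left _ 1, le_max_right _ 1⟩
  have hC0 : 0 ≤ C := by linarith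
  have hK0 : 0 ≤ K := by linarith
  have hν0 : 0 ≤ ν := by linarith
  have t1 : 0 ≤ C * ν := by positivity
  have t2 : 0 ≤ K * ν := by positivity
  have t3 : 0 ≤ C * ν * ‖selectB (2 * n) m‖ := by positivity
  have t4 : 0 ≤ ‖selectC (2 * n + 1) p‖ * (C * ν) := by positivity
  -- The summands control, in order, `D`, near orthogonality, `A`, `B` and `C`; taking `ε ≤ 1 / c`
  -- also secures every smallness condition.
  obtain ⟨c, hc⟩ : ∃ c, c = 1 + C * ν + K * ν + C * ν * ‖selectB (2 * n) m‖ +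
    ‖selectC (2 * n + 1) p‖ * (C * ν) := ⟨_, rfl⟩
  have hc0 : 0 < c := by linarith
  refine ⟨c, hc0, 1 / c, by positivity, fun ε => c * ε, ?_, ?_⟩
  · have : Tendsto (fun ε : ℝ => c * ε) (𝓝 0) (𝓝 (c * 0)) := by
      exact tendsto_id.const_mul c
    rw [mul_zero] at this
    exact this.mono_left nhdsWithin_le_nhds
  rintro Phat ⟨U, s, V, O, R, hO, hR, halg⟩ ε hε hεs e he Ptilde
    ⟨U', s', V', O', R', hO', hR', halg'⟩
  have hcε : c * ε ≤ 1 := by rwa [le_div_iff₀ hc0, mul_comm] at hεs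
  have u1 := mul_nonneg t1 hε.le
  have u2 := mul_nonneg t2 hε.le
  have u3 := mul_nonneg t3 hε.le
  have u4 := mul_nonneg t4 hε.le
  have hcε' : c * ε = ε + C * ν * ε + K * ν * ε + C * ν * ‖selectB (2 * n) m‖ * ε +
    ‖selectC (2 * n + 1) p‖ * (C * ν) * ε := by rw [hc]; ring
  -- `S j` depends only on the decompositions at `j`, so the same matrix serves the steps into and
  -- out of time `j`.
  set S : ℕ → Matrix (Fin n) (Fin n) ℝ := fun j =>
    (U j * diagonal fun i => Real.sqrt (s j i)⁻¹)ᵀ * O' j with hS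
  have hstep : ∀ j, 2 * n + 1 ≤ j → j + 4 * n ≤ N + 1 →
      IsLeadingSVD (hankel (2 * n + 1) (2 * n) (markov P) j) (U j) (s j) (V j) →
      IsLeadingSVD (hankel (2 * n + 1) (2 * n) (fun k l => markov P k l + e k l) j)
        (U' j) (s' j) (V' j) →
      ‖O j‖ ≤ C ∧
      (∃ L' : Matrix (Fin n) (Fin (2 * n) × Fin p) ℝ,
        L' * (shiftDown (2 * n) p * O j) = 1 ∧ ‖L'‖ ≤ C) ∧
      IsUnit (S j).det ∧ ‖S j‖ ≤ C ∧ ‖(S j)⁻¹‖ ≤ C ∧ ‖S j * R' j - R j‖ ≤ C * (ν * ε) ∧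
      ‖O' j * (S j)⁻¹ - O j‖ ≤ C * (ν * ε) ∧ ‖(S j)ᵀ * S j - 1‖ ≤ C * (ν * ε) := by
    intro j hj hj' h h'
    rw [hankel_add] at h'
    rw [hankel_markov P (by omega)] at h h'
    obtain ⟨h1, h2, h3⟩ := hbound j ⟨hj, hj'⟩ (U j) (s j) (V j) h
    have hE : ‖hankel (2 * n + 1) (2 * n) e j‖ ≤ ν * ε :=
      (he.norm_hankel_le hε.le hj hj').trans (by gcongr)
    have h4 := h3 _ (U' j) (s' j) (V' j) (S j) (ν * ε) h' hE (by linarith)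
      (by simp only [hS, hO'])
    rw [← hO, ← hO', ← hR, ← hR'] at h4
    rw [← hO] at h1 h2
    exact ⟨h1, h2, h4⟩
  clear_value S
  have hstep₀ := fun k (hk : k ∈ estimationTimes n N) =>
    hstep k hk.1 (by have := hk.2; omega) (halg k hk).1 (halg' k hk).1
  have hstep₁ := fun k (hk : k ∈ estimationTimes n N) =>
    hstep (k + 1) (by have := hk.1; omega) (by have := hk.2; omega) (halg k hk).2.1 (halg' k hk).2.1
  refine ⟨fun k => ⟨S (k + 1) * (Ptilde k).A * (S k)⁻¹, S (k + 1) * (Ptilde k).B,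
    (Ptilde k).C * (S k)⁻¹, (Ptilde k).D⟩, S, ⟨⟨C, ?_⟩, fun k _ => ⟨rfl, rfl, rfl, rfl⟩⟩, ?_, ?_⟩
  · rintro k hk j (rfl | rfl)
    · obtain ⟨-, -, h1, h2, h3, -⟩ := hstep₀ j hk
      exact ⟨h1, h2, h3⟩
    · obtain ⟨-, -, h1, h2, h3, -⟩ := hstep₁ k hk
      exact ⟨h1, h2, h3⟩
  · intro k hk
    obtain ⟨-, -, hA₁, hB₁, hC₁, hD₁⟩ := halg k hk
    obtain ⟨-, -, hA₂, hB₂, hC₂, hD₂⟩ := halg' k hk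
    obtain ⟨a1, -, -, -, -, -, a2, -⟩ := hstep₀ k hk
    obtain ⟨b1, ⟨L', hL', hLC⟩, b2, -, -, b3, b4, -⟩ := hstep₁ k hk
    refine ⟨?_, ?_, ?_, ?_⟩
    · have h1 : S (k + 1) * (Ptilde k).A * (S k)⁻¹ =
          leftInv (shiftDown (2 * n) p * (O' (k + 1) * (S (k + 1))⁻¹)) *
            (shiftUp (2 * n) p * (O' k * (S k)⁻¹)) := by
        rw [hA₂, ← Matrix.mul_assoc (shiftDown _ _), leftInv_mul_inv _ b2]
        simp only [Matrix.mul_assoc]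
      have h2 := hA hL' hLC b1 a1 b4 a2 (by linarith)
      simp only [h1, hA₁]
      linarith
    · have h1 : S (k + 1) * (Ptilde k).B - (Phat k).B =
          (S (k + 1) * R' (k + 1) - R (k + 1)) * selectB (2 * n) m := by
        rw [hB₁, hB₂, Matrix.sub_mul, Matrix.mul_assoc]
      have h2 := frobenius_norm_mul_le b3 (le_refl ‖selectB (2 * n) m‖)
      simp only [h1]
      linarith
    · have h1 : (Ptilde k).C * (S k)⁻¹ - (Phat k).C =
          selectC (2 * n + 1) p * (O' k * (S k)⁻¹ - O k) := by
        rw [hC₁, hC₂, Matrix.mul_sub, Matrix.mul_assoc]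
      have h2 := frobenius_norm_mul_le (le_refl ‖selectC (2 * n + 1) p‖) a2
      simp only [h1]
      linarith
    · have h1 : (Ptilde k).D - (Phat k).D = e k k := by
        rw [hD₁, hD₂]
        exact add_sub_cancel_left _ _
      have h2 := he k k (by have := hk.1; omega) le_rfl hk.1 (by have := hk.2; omega)
      simp only [h1]
      linarith
  · rintro k hk j (rfl | rfl)
    · obtain ⟨-, -, -, -, -, -, -, h⟩ := hstep₀ j hk
      linarith
    · obtain ⟨-, -, -, -, -, -, -, h⟩ := hstep₁ k hk
      linarith
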